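/- **Setting.** Let $K\ge 3$ be an odd number of users and let $W_1,\dots,W_N$ be files of $F$ bits each, ordered by non-increasing popularity, with $\binom K2\mid F$. A server is connected to the users by a shared error-free link. Let $N_h+N_r\le N$. The first $N_h$ files are high-level, the last $N_r$ files are zero-level, the others are low-level. Every file $W_n$ is split into $\binom K2$ sub-files $W_{n,s}$ of equal size, indexed by the 2-subsets $s$ of $[K]$. **Placement.** If $W_n$ is high-level, $W_{n,s}$ is stored by the two users in $s$. The sub-files of a low-level file are divided into $K$ disjoint sets of $\frac{K-1}2$ sub-files, and each user stores exactly one of these sets (a different one for each user). Zero-level files are not cached. **Demands.** Let $\mathbf d=(d_1,\dots,d_K)$ be a demand vector; $\mathcal K^h,\mathcal K^l,\mathcal K^r$ are the sets of users that request a high-, low-, zero-level file, $k^h,k^l,k^r$ their cardinalities, $\mathbf k=[k^h,k^l,k^r]$. For $i\in\mathcal K^h$, $j\in\mathcal K^l$ let $\mathcal H_{i,j}$ be the set of sub-files of $W_{d_j}$ stored by $i$ (more generally, $\mathcal H_{k,j}$ for any user $k$), and let $\Omega_{i,j}$ (resp. $\mathcal Z_{i,j}$) be the set of sub-files $W_{d_i,\{k,j\}}$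 with $k\in\mathcal K^h\setminus\{i\}$ (resp. $k\in\mathcal K^r$). The set $\Lambda_i=\{W_{d_i,s}: s\subseteq\mathcal K^l\}$ is partitioned into sets $\Lambda_{i,j}$, $j\in\mathcal K^l$, of sub-files stored by $j$ whose cardinalities differ by at most one, the partition of the index sets $s$ being the same for all $i$. Put, with $(x)^+=\max(x,0)$, $$\sigma_{i,j}=\big(|\Lambda_{i,j}|+|\mathcal Z_{i,j}|-|\mathcal H_{i,j}|\big)^+,\qquad n_{i,j}=\Big(|\Omega_{i,j}|-\big(|\mathcal H_{i,j}|-|\Lambda_{i,j}|-|\mathcal Z_{i,j}|\big)^+\Big)^+ .$$ Choose $\Pi_{i,j}\subseteq\mathcal Z_{i,j}$ with $|\mathcal Z_{i,j}\setminus\Pi_{i,j}|=\sigma_{i,j}$, $\Delta_{i,j}\subseteq\Omega_{i,j}$ with $|\Delta_{i,j}|=n_{i,j}$, and put $\mathcal F_{i,j}=\Lambda_{i,j}\cup\Pi_{i,j}\cup(\Omega_{i,j}\setminus\Delta_{i,j})$. **Delivery.** The server sends the following messages. 1. For every 3-subset $S\subseteq\mathcal K^h\cup\mathcal K^r$ with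 $S\not\subseteq\mathcal K^r$: $\bigoplus_{s\in S\cap\mathcal K^h}W_{d_s,S\setminus\{s\}}$. 2. For every pair $\{j,k\}\subseteq\mathcal K^l$: the XORs $w\oplus w'$ of the sub-files $w\in\mathcal H_{k,j}$ with the sub-files $w'\in\mathcal H_{j,k}$ matched to them by a bijection. 3. For every $i\in\mathcal K^h$, $j\in\mathcal K^l$, given an injection $\mathcal F_{i,j}\to\mathcal H_{i,j}$: every sub-file in $\mathcal H_{i,j}$, XORed with the member of $\mathcal F_{i,j}$ mapped to it (if there is one). 4. The sub-files in the sets $\Delta_{i,j}$ (each counted for the user $i$ requesting it), grouped into XORs of two sub-files, requested by two distinct high-level users each of which stores the sub-file requested by the other, with at most one sub-file left over and sent alone. 5. Unicasts: the sub-files requested by low-level users and stored by zero-level users; the sub-files in the sets $\mathcal Z_{i,j}\setminus\Pi_{i,j}$; all the sub-files of the file requested by each zero-level user. **Claim.** Such placements exist, and each of them uses exactly $MF$ bits of cache at every user, where $M=\frac{N_h+N-N_r}{K}$. For every such placement and every $\mathbf d$ the choices required by the delivery can be made, and however they are made: * $|\mathcal Z_{i,j}|=k^r$, $|\Omega_{i,j}|=k^h-1$,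 $|\mathcal H_{i,j}|=\frac{K-1}2$ and $|\Lambda_{i,j}|\in\{\lfloor\frac{k^l-1}2\rfloor,\lceil\frac{k^l-1}2\rceil\}$ in the formulas for $\sigma_{i,j}$ and $n_{i,j}$; and $|\mathcal F_{i,j}|=|\mathcal H_{i,j}|$ unless $k^h=1$ and $k^r=0$; * apart from the $k^r\binom K2$ unicasts to zero-level users, the number of messages sent is $$N_T(\mathbf k)=\underbrace{\tbinom{k^h+k^r}3-\tbinom{k^r}3}_{\text{Step 1}}+\underbrace{\tfrac{K-1}2\tbinom{k^l}2}_{\text{Step 2}}+\underbrace{\tfrac{K-1}2k^hk^l}_{\text{Step 3}}+\underbrace{\Big\lceil\tfrac12\sum_{i,j}n_{i,j}\Big\rceil}_{\text{Step 4}}+\underbrace{k^lk^r\tfrac{K-1}2+\sum_{i,j}\sigma_{i,j}}_{\text{Step 5}},$$ which depends on $\mathbf d$ only through $\mathbf k$: for each $i$, exactly $\lceil k^l/2\rceil$ of the sets $\Lambda_{i,j}$ can be taken to have $\lfloor\frac{k^l-1}2\rfloor$ elements and the other $\lfloor k^l/2\rfloor$ to have $\lceil\frac{k^l-1}2\rceil$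 elements in evaluating the sums; * every user recovers the requested file from the messages and the own cache, and the number of bits sent, divided by $F$, is $$R(\mathbf k)=\frac{N_T(\mathbf k)}{\binom K2}+k^r .$$ -/

import Mathlib

open Finset

namespace CL210

/-- Indices of sub-files: the 2-subsets of the set of `K` users; every file has `C(K,2)` sub-files. -/
abbrev Pair (K : ℕ) : Type := {s : Finset (Fin K) // s.card = 2}

/-- The sub-file `W_{n,s}`, as a label: a file `n` and a 2-subset `s` of users. -/
abbrev SubFile (K N : ℕ) : Type := Fin N × Pair K

/-- The content of a sub-file: `b` bits, with addition in `ZMod 2` as XOR.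
A file thus consists of `F = C(K,2) * b` bits. -/
abbrev Bits (b : ℕ) : Type := Fin b → ZMod 2

/-- A realization of the whole library. -/
abbrev Library (K N b : ℕ) : Type := Fin N → Pair K → Bits b

/-- The file size in bits. -/
def fileSize (K b : ℕ) : ℕ := K.choose 2 * b

/-! Files are indexed by popularity rank (file `0` is the most popular one): the first `Nh` files are
high-level, the last `Nr` files are not cached (zero-level), those in between are low-level. -/

def IsHigh {N : ℕ} (Nh : ℕ) (n : Fin N) : Prop := n.val < Nh
def IsZero {N : ℕ} (Nr : ℕ) (n : Fin N) : Prop := N ≤ n.val + Nr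
def IsLow {N : ℕ} (Nh Nr : ℕ) (n : Fin N) : Prop := ¬ IsHigh Nh n ∧ ¬ IsZero Nr n

instance {N : ℕ} (Nh : ℕ) : DecidablePred (IsHigh (N := N) Nh) :=
  fun n => inferInstanceAs (Decidable (n.val < Nh))
instance {N : ℕ} (Nr : ℕ) : DecidablePred (IsZero (N := N) Nr) :=
  fun n => inferInstanceAs (Decidable (N ≤ n.val + Nr))
instance {N : ℕ} (Nh Nr : ℕ) : DecidablePred (IsLow (N := N) Nh Nr) :=
  fun n => inferInstanceAs (Decidable (¬ IsHigh Nh n ∧ ¬ IsZero Nr n))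

/-- Placement. The placement of high-level and zero-level files is fixed (see `Caches`). The sub-files
of each low-level file are divided into `K` disjoint subsets of equal size `(K-1)/2`, one for each
user: `owner n s` is the only user that stores the sub-file `s` of the low-level file `n` (the values
of `owner` at other files are not used). -/
structure Placement (K N Nh Nr : ℕ) where
  owner : Fin N → Pair K → Fin K
  balanced : ∀ n, IsLow Nh Nr n → ∀ u : Fin K,
    (univ.filter fun s : Pair K => owner n s = u).card = (K - 1) / 2

variable {K N Nh Nr : ℕ}

/-- User `u` stores the sub-file `x`: for a high-level file if `u` belongs to the index of the
sub-file, for a low-level file if `u` is its owner, never for a zero-level file. -/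
def Placement.Caches (P : Placement K N Nh Nr) (u : Fin K) (x : SubFile K N) : Prop :=
  (IsHigh Nh x.1 ∧ u ∈ x.2.1) ∨ (IsLow Nh Nr x.1 ∧ P.owner x.1 x.2 = u)

instance (P : Placement K N Nh Nr) (u : Fin K) : DecidablePred (P.Caches u) :=
  fun x => inferInstanceAs (Decidable
    ((IsHigh Nh x.1 ∧ u ∈ x.2.1) ∨ (IsLow Nh Nr x.1 ∧ P.owner x.1 x.2 = u)))

/-- The set of sub-files stored by user `u`. -/
def Placement.cache (P : Placement K N Nh Nr) (u : Fin K) : Finset (SubFile K N) :=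
  univ.filter (P.Caches u)

/-- The normalized cache size of the scheme: `(Nh (t-1) + (N - Nr)) / K` with `t = 2`. -/
def cacheSize (K N Nh Nr : ℕ) : ℚ := ((Nh : ℚ) + ((N : ℚ) - (Nr : ℚ))) / (K : ℚ)

/-- High-level, low-level and zero-level users for the demand vector `d`. -/
def Kh (Nh : ℕ) (d : Fin K → Fin N) : Finset (Fin K) := univ.filter fun u => IsHigh Nh (d u)
def Kl (Nh Nr : ℕ) (d : Fin K → Fin N) : Finset (Fin K) := univ.filter fun u => IsLow Nh Nr (d u)
def Kr (Nr : ℕ) (d : Fin K → Fin N) : Finset (Fin K) := univ.filter fun u => IsZero Nr (d u)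

/-- `H_{i,j}`: the sub-files stored by user `i` of the (low-level) file requested by user `j`. -/
def setH (P : Placement K N Nh Nr) (d : Fin K → Fin N) (i j : Fin K) : Finset (Pair K) :=
  univ.filter fun s => P.owner (d j) s = i

/-- `L_{i,j}`: the sub-files requested by the high-level user `i` (so not stored by `i`) and stored
by the low-level user `j`. -/
def setL (i j : Fin K) : Finset (Pair K) := univ.filter fun s => i ∉ s.1 ∧ j ∈ s.1

/-- `Ω_{i,j}`: the members of `L_{i,j}` that are also stored by a high-level user. -/
def setOmega (Nh : ℕ) (d : Fin K → Fin N) (i j : Fin K) : Finset (Pair K) :=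
  (setL i j).filter fun s => ∃ k ∈ Kh Nh d, k ∈ s.1

/-- `Z_{i,j}`: the members of `L_{i,j}` that are also stored by a zero-level user. -/
def setZ (Nr : ℕ) (d : Fin K → Fin N) (i j : Fin K) : Finset (Pair K) :=
  (setL i j).filter fun s => ∃ r ∈ Kr Nr d, r ∈ s.1

/-- `Λ_i`: the sub-files requested by the high-level user `i` and stored by low-level users only.
As a set of indices it is the same for all `i`. -/
def setLambda (Nh Nr : ℕ) (d : Fin K → Fin N) : Finset (Pair K) :=
  univ.filter fun s => s.1 ⊆ Kl Nh Nr d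

/-- `σ_{i,j} = (|Λ_{i,j}| + |Z_{i,j}| - |H_{i,j}|)^+` (truncated subtraction). -/
def sigmaOf (lam z h : ℕ) : ℕ := lam + z - h

/-- `n_{i,j} = |Ω_{i,j}| - (|H_{i,j}| - |Λ_{i,j}| - |Z_{i,j}|)^+`, cut off at `0`. The cut-off matters
only for a single high-level user in the absence of zero-level users. -/
def nOf (om lam z h : ℕ) : ℕ := om - (h - (lam + z))

/-- All choices made by the delivery phase for the demand vector `d`. Sub-files requested by
a high-level user `i` are denoted by their index `s`, standing for `W_{d_i,s}`. -/
structure Delivery (P : Placement K N Nh Nr) (d : Fin K → Fin N) where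
  /-- Step 2: for low-level users `j < k`, a one-to-one correspondence of the sub-files wanted by `j`
  and stored by `k` with the sub-files wanted by `k` and stored by `j`. -/
  lowPair : Fin K → Fin K → Pair K → Pair K
  lowPair_bij : ∀ j ∈ Kl Nh Nr d, ∀ k ∈ Kl Nh Nr d, j < k →
    Set.BijOn (lowPair j k) (setH P d k j) (setH P d j k)
  /-- `Λ_{i,j}`: approximately uniform partition of `Λ_i`, the same one for all `i`. -/
  Lam : Fin K → Fin K → Finset (Pair K)
  Lam_subset : ∀ i ∈ Kh Nh d, ∀ j ∈ Kl Nh Nr d, Lam i j ⊆ setL i j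
  Lam_cover : ∀ i ∈ Kh Nh d, (Kl Nh Nr d).biUnion (Lam i) = setLambda Nh Nr d
  Lam_disjoint : ∀ i ∈ Kh Nh d, ∀ j ∈ Kl Nh Nr d, ∀ k ∈ Kl Nh Nr d, j ≠ k →
    Disjoint (Lam i j) (Lam i k)
  Lam_uniform : ∀ i ∈ Kh Nh d, ∀ j ∈ Kl Nh Nr d, ∀ k ∈ Kl Nh Nr d,
    (Lam i k).card ≤ (Lam i j).card + 1
  Lam_same : ∀ i ∈ Kh Nh d, ∀ i' ∈ Kh Nh d, ∀ j ∈ Kl Nh Nr d, Lam i j = Lam i' j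
  /-- `Π_{i,j}`: what is left of `Z_{i,j}` when `σ_{i,j}` sub-files are removed. -/
  Pi : Fin K → Fin K → Finset (Pair K)
  Pi_subset : ∀ i ∈ Kh Nh d, ∀ j ∈ Kl Nh Nr d, Pi i j ⊆ setZ Nr d i j
  Pi_card : ∀ i ∈ Kh Nh d, ∀ j ∈ Kl Nh Nr d, (setZ Nr d i j \ Pi i j).card =
    sigmaOf (Lam i j).card (setZ Nr d i j).card (setH P d i j).card
  /-- `Δ_{i,j}`: the `n_{i,j}` sub-files in `Ω_{i,j}` that are not used in cross-level messages. -/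
  Del : Fin K → Fin K → Finset (Pair K)
  Del_subset : ∀ i ∈ Kh Nh d, ∀ j ∈ Kl Nh Nr d, Del i j ⊆ setOmega Nh d i j
  Del_card : ∀ i ∈ Kh Nh d, ∀ j ∈ Kl Nh Nr d, (Del i j).card =
    nOf (setOmega Nh d i j).card (Lam i j).card (setZ Nr d i j).card (setH P d i j).card
  /-- Step 3: the members of `F_{i,j} = Λ_{i,j} ∪ Π_{i,j} ∪ (Ω_{i,j} \ Δ_{i,j})` are paired with
  distinct members of `H_{i,j}`. -/
  cross : Fin K → Fin K → Pair K → Pair K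
  cross_maps : ∀ i ∈ Kh Nh d, ∀ j ∈ Kl Nh Nr d,
    ∀ s ∈ Lam i j ∪ Pi i j ∪ (setOmega Nh d i j \ Del i j), cross i j s ∈ setH P d i j
  cross_inj : ∀ i ∈ Kh Nh d, ∀ j ∈ Kl Nh Nr d, Set.InjOn (cross i j)
    (Lam i j ∪ Pi i j ∪ (setOmega Nh d i j \ Del i j) : Finset (Pair K))
  /-- Step 4: the sub-files in all the sets `Δ_{i,j}`, tagged by the requesting user `i`, are divided
  into pairs of sub-files, and at most one single sub-file. The two sub-files of a pair are requested
  by two different high-level users, each of which stores what the other one requests. -/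
  B : Finpartition (univ.filter fun x : Fin K × Pair K =>
    x.1 ∈ Kh Nh d ∧ ∃ j ∈ Kl Nh Nr d, x.2 ∈ Del x.1 j)
  B_parts : ∀ p ∈ B.parts, p.card = 1 ∨
    ∃ i k : Fin K, ∃ s t : Pair K, i ≠ k ∧ i ∈ t.1 ∧ k ∈ s.1 ∧ p = {(i, s), (k, t)}
  B_single : (B.parts.filter fun p => p.card = 1).card ≤ 1

namespace Delivery

variable {P : Placement K N Nh Nr} {d : Fin K → Fin N} (D : Delivery P d)

/-- `F_{i,j}`. -/
def F (i j : Fin K) : Finset (Pair K) := D.Lam i j ∪ D.Pi i j ∪ (setOmega Nh d i j \ D.Del i j)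

/-- `σ_{i,j}`. -/
def sigma (i j : Fin K) : ℕ :=
  sigmaOf (D.Lam i j).card (setZ Nr d i j).card (setH P d i j).card

/-- `n_{i,j}`. -/
def n (i j : Fin K) : ℕ :=
  nOf (setOmega Nh d i j).card (D.Lam i j).card (setZ Nr d i j).card (setH P d i j).card

/-! The transmitted messages. For every step, a finite set that indexes the messages and, for
every index, the set of sub-files whose XOR is sent. -/

/-- Step 1: the 3-subsets of `K^h ∪ K^r` that are not contained in `K^r`. -/
def step1 (_D : Delivery P d) : Finset (Finset (Fin K)) :=
  (powersetCard 3 (Kh Nh d ∪ Kr Nr d)).filter fun S => ¬ S ⊆ Kr Nr d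

/-- The XOR of `W_{d_s, S \ {s}}` over the high-level users `s` in `S`. -/
def msg1 (_D : Delivery P d) (S : Finset (Fin K)) : Finset (SubFile K N) :=
  univ.filter fun x => ∃ s ∈ S, s ∈ Kh Nh d ∧ x.1 = d s ∧ x.2.1 = S.erase s

/-- Step 2: triples `(j, k, s)`, where `s` is wanted by `j` and stored by `k`. -/
def step2 (_D : Delivery P d) : Finset (Fin K × Fin K × Pair K) :=
  univ.filter fun x => x.1 ∈ Kl Nh Nr d ∧ x.2.1 ∈ Kl Nh Nr d ∧ x.1 < x.2.1 ∧
    x.2.2 ∈ setH P d x.2.1 x.1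

def msg2 (x : Fin K × Fin K × Pair K) : Finset (SubFile K N) :=
  {(d x.1, x.2.2), (d x.2.1, D.lowPair x.1 x.2.1 x.2.2)}

/-- Step 3: triples `(i, j, h)` with `i` high-level, `j` low-level and `h ∈ H_{i,j}`. -/
def step3 (_D : Delivery P d) : Finset (Fin K × Fin K × Pair K) :=
  univ.filter fun x => x.1 ∈ Kh Nh d ∧ x.2.1 ∈ Kl Nh Nr d ∧ x.2.2 ∈ setH P d x.1 x.2.1

/-- The XOR of `W_{d_j,h}` and of `W_{d_i,s}` for the `s ∈ F_{i,j}` that is paired with `h`. -/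
def msg3 (x : Fin K × Fin K × Pair K) : Finset (SubFile K N) :=
  insert (d x.2.1, x.2.2)
    (((D.F x.1 x.2.1).filter fun s => D.cross x.1 x.2.1 s = x.2.2).image fun s => (d x.1, s))

/-- Step 4: the parts of the partition `B`. -/
def step4 : Finset (Finset (Fin K × Pair K)) := D.B.parts

def msg4 (_D : Delivery P d) (p : Finset (Fin K × Pair K)) : Finset (SubFile K N) :=
  p.image fun x => (d x.1, x.2)

/-- Step 5, unicasts to low-level users `j` of the requested sub-files stored by zero-level users. -/
def step5low (_D : Delivery P d) : Finset (Fin K × Pair K) :=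
  univ.filter fun x => x.1 ∈ Kl Nh Nr d ∧ P.owner (d x.1) x.2 ∈ Kr Nr d

/-- Step 5, unicasts to high-level users `i` of the sub-files in `Z_{i,j} \ Π_{i,j}`. -/
def step5high : Finset (Fin K × Fin K × Pair K) :=
  univ.filter fun x => x.1 ∈ Kh Nh d ∧ x.2.1 ∈ Kl Nh Nr d ∧
    x.2.2 ∈ setZ Nr d x.1 x.2.1 \ D.Pi x.1 x.2.1

/-- Step 5, unicasts to zero-level users of all the sub-files of the requested files. -/
def step5zero (_D : Delivery P d) : Finset (Fin K × Pair K) :=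
  univ.filter fun x => x.1 ∈ Kr Nr d

/-- The index type of all the messages sent over the shared link. -/
abbrev Index : Type :=
  D.step1 ⊕ D.step2 ⊕ D.step3 ⊕ D.step4 ⊕ D.step5low ⊕ D.step5high ⊕ D.step5zero

/-- The set of sub-files whose XOR is the given message. -/
def msg : D.Index → Finset (SubFile K N)
  | .inl S => D.msg1 S
  | .inr (.inl x) => D.msg2 x
  | .inr (.inr (.inl x)) => D.msg3 x
  | .inr (.inr (.inr (.inl p))) => D.msg4 p
  | .inr (.inr (.inr (.inr (.inl x)))) => {(d x.1.1, x.1.2)}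
  | .inr (.inr (.inr (.inr (.inr (.inl x))))) => {(d x.1.1, x.1.2.2)}
  | .inr (.inr (.inr (.inr (.inr (.inr x))))) => {(d x.1.1, x.1.2)}

/-- The content of the messages for the library `W`. -/
def transmit {b : ℕ} (W : Library K N b) (m : D.Index) : Bits b :=
  ∑ x ∈ D.msg m, W x.1 x.2

/-- Every user can compute the requested file from the transmitted messages and the content of the
own cache, whatever the content of the library. -/
def Decodable (b : ℕ) : Prop :=
  ∀ u : Fin K, ∃ dec : (D.Index → Bits b) → (P.cache u → Bits b) → (Pair K → Bits b),
    ∀ W : Library K N b, dec (D.transmit W) (fun x => W x.1.1 x.1.2) = W (d u)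

/-- The delivery rate: the number of bits sent over the shared link, divided by the file size. -/
def rate (b : ℕ) : ℚ := ((Fintype.card D.Index * b : ℕ) : ℚ) / (fileSize K b : ℚ)

end Delivery

/-- `∑_{i,j} σ_{i,j}` as a function of `k = [kh, kl, kr]`. Of the `kl` sets `Λ_{i,j}`,
`⌈kl/2⌉` have `⌊(kl-1)/2⌋` elements and `⌊kl/2⌋` have `⌈(kl-1)/2⌉ = ⌊kl/2⌋` elements
(all have `(kl-1)/2` elements if `kl` is odd); moreover `|Z| = kr` and `|H| = (K-1)/2`. -/
def sigmaSum (K kh kl kr : ℕ) : ℕ :=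
  kh * ((kl - kl / 2) * sigmaOf ((kl - 1) / 2) kr ((K - 1) / 2) +
    (kl / 2) * sigmaOf (kl / 2) kr ((K - 1) / 2))

/-- `∑_{i,j} n_{i,j}` as a function of `k = [kh, kl, kr]`, with `|Ω| = kh - 1`. -/
def nSum (K kh kl kr : ℕ) : ℕ :=
  kh * ((kl - kl / 2) * nOf (kh - 1) ((kl - 1) / 2) kr ((K - 1) / 2) +
    (kl / 2) * nOf (kh - 1) (kl / 2) kr ((K - 1) / 2))

/-- The number `N_T(k)` of messages, where the unicasts to zero-level users are not counted. -/
def NT (K kh kl kr : ℕ) : ℕ :=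
  ((kh + kr).choose 3 - kr.choose 3) + (K - 1) / 2 * kl.choose 2 + (K - 1) / 2 * (kh * kl) +
    ⌈(nSum K kh kl kr : ℚ) / 2⌉₊ + (kl * kr * ((K - 1) / 2) + sigmaSum K kh kl kr)

end CL210

/-! Counting. A pair through a low-level user `j` that avoids the high-level user `i` is determined
by its other member, which gives `|Ω| = kh - 1` and `|Z| = kr`. The sets `Λ_{i,j}` have nearly equal
sizes adding up to `C(kl,2)`, and this forces the multiset of their sizes (`sum_uniform`). Hence
every sum over `i, j` depends on the demand only through `[kh, kl, kr]`, and the number of messages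
follows step by step.

Decoding. The messages are linear in the library, so it suffices that a requested sub-file vanishes
whenever all messages and the cached sub-files vanish. Each requested sub-file is either cached or
occurs in a message whose other members are all cached by the requesting user (`determined_low`,
`determined_high`, `determined_zero`).

Existence. Any bijection from the pairs to `K × (K-1)/2` gives a placement, and a nearly regular
tournament on the low-level users gives the sets `Λ_{i,j}`. The delicate point is Step 4. View
`W_{d_i,{j,k}}` with `i, k` high and `j` low as an arc from `i` to `k` in a digraph attached to `j`.
Opposite arcs, even in different digraphs, are sub-files that can be XORed. As `Λ_{i,j}` does not
depend on `i`, neither does `n_{i,j}`, so each digraph needs constant out-degree. It can be chosen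
symmetric except for one arc when the number of its arcs is odd (`exists_regular_digraph`). The
exceptional arcs of different digraphs are oriented so as to cancel in pairs, leaving at most one
(`exists_paired_digraphs`). -/

namespace CL210

variable {K N Nh Nr : ℕ}

/-! ### Classes of users and sizes of the index sets. -/

theorem mem_Kh {d : Fin K → Fin N} {u : Fin K} : u ∈ Kh Nh d ↔ IsHigh Nh (d u) := by simp [Kh]

theorem mem_Kl {d : Fin K → Fin N} {u : Fin K} : u ∈ Kl Nh Nr d ↔ IsLow Nh Nr (d u) := by
  simp [Kl]

theorem mem_Kr {d : Fin K → Fin N} {u : Fin K} : u ∈ Kr Nr d ↔ IsZero Nr (d u) := by simp [Kr]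

theorem not_isZero_of_isHigh (hN : Nh + Nr ≤ N) {n : Fin N} (h : IsHigh Nh n) : ¬ IsZero Nr n := by
  unfold IsHigh at h
  unfold IsZero
  omega

theorem disjoint_Kh_Kr (hN : Nh + Nr ≤ N) (d : Fin K → Fin N) : Disjoint (Kh Nh d) (Kr Nr d) :=
  disjoint_left.2 fun _ h h' => not_isZero_of_isHigh hN (mem_Kh.1 h) (mem_Kr.1 h')

theorem disjoint_Kh_Kl (d : Fin K → Fin N) : Disjoint (Kh Nh d) (Kl Nh Nr d) :=
  disjoint_left.2 fun _ h h' => (mem_Kl.1 h').1 (mem_Kh.1 h)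

theorem disjoint_Kr_Kl (d : Fin K → Fin N) : Disjoint (Kr Nr d) (Kl Nh Nr d) :=
  disjoint_left.2 fun _ h h' => (mem_Kl.1 h').2 (mem_Kr.1 h)

theorem level_cases (Nh Nr : ℕ) (d : Fin K → Fin N) (u : Fin K) :
    u ∈ Kh Nh d ∨ u ∈ Kl Nh Nr d ∨ u ∈ Kr Nr d := by
  rw [mem_Kh, mem_Kl, mem_Kr, IsLow]
  tauto

theorem card_levels (hN : Nh + Nr ≤ N) (d : Fin K → Fin N) :
    (Kh Nh d).card + (Kl Nh Nr d).card + (Kr Nr d).card = K := by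
  have h : Kh Nh d ∪ Kl Nh Nr d ∪ Kr Nr d = univ := by
    ext u
    have := level_cases Nh Nr d u
    simp only [mem_union, mem_univ, iff_true]
    tauto
  rw [← card_union_of_disjoint (disjoint_Kh_Kl d), ← card_union_of_disjoint, h, card_univ,
    Fintype.card_fin]
  exact disjoint_union_left.2 ⟨disjoint_Kh_Kr hN d, (disjoint_Kr_Kl d).symm⟩

theorem card_pairs (K : ℕ) : Fintype.card (Pair K) = K.choose 2 := by
  rw [Fintype.card_finset_len, Fintype.card_fin]

theorem choose_two_of_odd (hK : Odd K) : K.choose 2 = K * ((K - 1) / 2) := by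
  obtain ⟨m, rfl⟩ := hK
  rw [Nat.choose_two_right, Nat.mul_div_assoc]
  exact ⟨m, by omega⟩

theorem pair_eq_of_mem {s : Pair K} {a c : Fin K} (ha : a ∈ s.1) (hc : c ∈ s.1) (hac : a ≠ c) :
    s.1 = {a, c} := by
  refine (eq_of_subset_of_card_le ?_ ?_).symm
  · intro x hx
    rcases mem_insert.1 hx with rfl | hx
    · exact ha
    · rw [mem_singleton.1 hx]; exact hc
  · rw [s.2, card_pair hac]

theorem exists_pair_eq (s : Pair K) {a : Fin K} (ha : a ∈ s.1) : ∃ c, c ≠ a ∧ s.1 = {a, c} := by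
  obtain ⟨c, hc, hca⟩ := exists_mem_ne (by rw [s.2]; norm_num : 1 < s.1.card) a
  exact ⟨c, hca, pair_eq_of_mem ha hc hca.symm⟩

/-- The pairs through `j` that avoid `i` and meet `A` correspond to the members of `A \ {i}`. -/
theorem card_filter_setL {A : Finset (Fin K)} {i j : Fin K} (hj : j ∉ A) (hij : i ≠ j) :
    ((setL i j).filter fun s => ∃ k ∈ A, k ∈ s.1).card = (A.erase i).card := by
  have ne : ∀ a ∈ A.erase i, a ≠ j := by
    rintro a ha rfl
    exact hj (mem_of_mem_erase ha)
  refine (card_bij (fun a ha => (⟨{a, j}, card_pair (ne a ha)⟩ : Pair K)) ?_ ?_ ?_).symm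
  · intro a ha
    simp only [setL, mem_filter, mem_univ, true_and, mem_insert, mem_singleton]
    refine ⟨⟨?_, by simp⟩, a, mem_of_mem_erase ha, by simp⟩
    rintro (h | h)
    · exact ne_of_mem_erase ha h.symm
    · exact hij h
  · intro a ha c hc h
    have h1 : a ∈ ({c, j} : Finset (Fin K)) := by
      rw [← Subtype.mk.inj h]; exact mem_insert_self _ _
    rcases mem_insert.1 h1 with h2 | h2
    · exact h2
    · exact absurd (mem_singleton.1 h2) (ne a ha)
  · intro s hs
    simp only [setL, mem_filter, mem_univ, true_and] at hs
    obtain ⟨⟨his, hjs⟩, k, hk, hks⟩ := hs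
    refine ⟨k, mem_erase.2 ⟨?_, hk⟩, Subtype.ext ?_⟩
    · rintro rfl; exact his hks
    · refine (pair_eq_of_mem hks hjs ?_).symm
      rintro rfl; exact hj hk

section Cards

variable {P : Placement K N Nh Nr} {d : Fin K → Fin N} {i j : Fin K}

theorem card_setH (hj : j ∈ Kl Nh Nr d) (i : Fin K) : (setH P d i j).card = (K - 1) / 2 :=
  P.balanced _ (mem_Kl.1 hj) i

theorem ne_of_mem_Kh_of_mem_Kl (hi : i ∈ Kh Nh d) (hj : j ∈ Kl Nh Nr d) : i ≠ j := by
  rintro rfl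
  exact disjoint_left.1 (disjoint_Kh_Kl d) hi hj

theorem card_setOmega (hi : i ∈ Kh Nh d) (hj : j ∈ Kl Nh Nr d) :
    (setOmega Nh d i j).card = (Kh Nh d).card - 1 := by
  rw [setOmega, card_filter_setL (disjoint_right.1 (disjoint_Kh_Kl d) hj)
    (ne_of_mem_Kh_of_mem_Kl hi hj), card_erase_of_mem hi]

theorem card_setZ (hN : Nh + Nr ≤ N) (hi : i ∈ Kh Nh d) (hj : j ∈ Kl Nh Nr d) :
    (setZ Nr d i j).card = (Kr Nr d).card := by
  rw [setZ, card_filter_setL (disjoint_right.1 (disjoint_Kr_Kl d) hj)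
    (ne_of_mem_Kh_of_mem_Kl hi hj), erase_eq_of_notMem (disjoint_left.1 (disjoint_Kh_Kr hN d) hi)]

theorem card_setLambda (Nh Nr : ℕ) (d : Fin K → Fin N) :
    (setLambda Nh Nr d).card = (Kl Nh Nr d).card.choose 2 := by
  rw [← card_powersetCard, ← card_map (Function.Embedding.subtype _)]
  congr 1
  ext s
  simp only [setLambda, mem_map, mem_filter, mem_univ, true_and, Function.Embedding.coe_subtype,
    mem_powersetCard, Subtype.exists, exists_and_right, exists_eq_right]
  exact ⟨fun ⟨a, c⟩ => ⟨c, a⟩, fun ⟨a, c⟩ => ⟨c, a⟩⟩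

theorem mem_setL {s : Pair K} : s ∈ setL i j ↔ i ∉ s.1 ∧ j ∈ s.1 := by simp [setL]

theorem mem_setOmega {s : Pair K} :
    s ∈ setOmega Nh d i j ↔ (i ∉ s.1 ∧ j ∈ s.1) ∧ ∃ k ∈ Kh Nh d, k ∈ s.1 := by
  rw [setOmega, mem_filter, mem_setL]

theorem mem_setZ {s : Pair K} :
    s ∈ setZ Nr d i j ↔ (i ∉ s.1 ∧ j ∈ s.1) ∧ ∃ k ∈ Kr Nr d, k ∈ s.1 := by
  rw [setZ, mem_filter, mem_setL]

theorem mem_setH {s : Pair K} : s ∈ setH P d i j ↔ P.owner (d j) s = i := by simp [setH]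

theorem mem_setLambda {s : Pair K} : s ∈ setLambda Nh Nr d ↔ s.1 ⊆ Kl Nh Nr d := by
  simp [setLambda]

/-- One of the two members of such a pair is high-level, which leaves room for a single low-level
one. So the sets `Ω_{i,j}` with fixed `i` are disjoint, and Step 4 counts nothing twice. -/
theorem setOmega_unique_low {s : Pair K} {j' : Fin K} (hs : s ∈ setOmega Nh d i j)
    (hj : j ∈ Kl Nh Nr d) (hj' : j' ∈ Kl Nh Nr d) (hs' : j' ∈ s.1) : j = j' := by
  obtain ⟨⟨-, hjs⟩, k, hk, hks⟩ := mem_setOmega.1 hs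
  rw [pair_eq_of_mem hks hjs (ne_of_mem_Kh_of_mem_Kl hk hj)] at hs'
  rcases mem_insert.1 hs' with h | h
  · exact absurd h.symm (ne_of_mem_Kh_of_mem_Kl hk hj')
  · exact (mem_singleton.1 h).symm

end Cards

/-! ### Nearly equal numbers with a prescribed sum. -/

/-- A family of `c` natural numbers that differ by at most one and add up to `C(c,2)`. -/
theorem uniform_values {ι : Type*} {A : Finset ι} {f : ι → ℕ}
    (hu : ∀ j ∈ A, ∀ k ∈ A, f k ≤ f j + 1) (hs : ∑ j ∈ A, f j = A.card.choose 2) {j : ι}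
    (hj : j ∈ A) : f j = (A.card - 1) / 2 ∨ f j = A.card / 2 := by
  have h2 : A.card.choose 2 * 2 = A.card * (A.card - 1) := by
    rw [mul_comm A.card, Nat.choose_two_right, mul_comm A.card,
      Nat.div_mul_cancel (Nat.even_mul_pred_self _ |>.two_dvd |> (by rwa [mul_comm] at ·))]
  have hpos : 0 < A.card := card_pos.2 ⟨j, hj⟩
  -- A value below `(c-1)/2` would bound all the others by `(c-1)/2`, so the sum would be less than
  -- `c * ((c-1)/2)`, which is at most `C(c,2)`. `hhigh` is the mirror image.
  have hlow : ¬ f j + 1 ≤ (A.card - 1) / 2 := by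
    intro h
    have : ∑ k ∈ A, f k < ∑ k ∈ A, (A.card - 1) / 2 :=
      sum_lt_sum (fun k hk => (hu j hj k hk).trans h) ⟨j, hj, by omega⟩
    rw [hs, sum_const, smul_eq_mul] at this
    have h3 : A.card * ((A.card - 1) / 2) * 2 ≤ A.card * (A.card - 1) := by
      rw [mul_assoc]; exact Nat.mul_le_mul_left _ (by omega)
    omega
  have hhigh : ¬ A.card / 2 + 1 ≤ f j := by
    intro h
    have : ∑ k ∈ A, A.card / 2 < ∑ k ∈ A, f k :=
      sum_lt_sum (fun k hk => by have := hu k hk j hj; omega) ⟨j, hj, by omega⟩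
    rw [hs, sum_const, smul_eq_mul] at this
    have h3 : A.card * (A.card - 1) ≤ A.card * (A.card / 2) * 2 := by
      rw [mul_assoc]; exact Nat.mul_le_mul_left _ (by omega)
    omega
  omega

/-- For odd cardinality all values coincide. For cardinality `2c` the values are `c - 1` and `c`,
and the total `c(2c - 1)` forces each to occur exactly `c` times. -/
theorem sum_uniform {ι : Type*} {A : Finset ι} {f : ι → ℕ}
    (hu : ∀ j ∈ A, ∀ k ∈ A, f k ≤ f j + 1) (hs : ∑ j ∈ A, f j = A.card.choose 2) (g : ℕ → ℕ) :
    ∑ j ∈ A, g (f j) = (A.card - A.card / 2) * g ((A.card - 1) / 2) +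
      A.card / 2 * g (A.card / 2) := by
  have hv := fun j hj => uniform_values hu hs (j := j) hj
  rcases Nat.even_or_odd' A.card with ⟨c, hc | hc⟩
  · rcases Nat.eq_zero_or_pos c with rfl | hpos
    · rw [card_eq_zero.1 hc]; simp
    have e1 : (A.card - 1) / 2 = c - 1 := by omega
    have e2 : A.card / 2 = c := by omega
    have e3 : A.card - c = c := by omega
    rw [e1, e2] at hv
    rw [e1, e2, e3]
    classical
    -- Stated for all `g`: the case `g = id` determines the two multiplicities, which are then used
    -- for the given `g`.
    have key : ∀ g : ℕ → ℕ, ∑ j ∈ A, g (f j) =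
        (A.filter fun j => ¬ f j = c).card * g (c - 1) + (A.filter fun j => f j = c).card * g c := by
      intro g
      rw [← sum_filter_add_sum_filter_not A (fun j => f j = c), add_comm]
      congr 1
      · rw [← smul_eq_mul, ← sum_const]
        refine sum_congr rfl fun j hj => ?_
        rw [mem_filter] at hj
        rw [(hv j hj.1).resolve_right hj.2]
      · rw [← smul_eq_mul, ← sum_const]
        refine sum_congr rfl fun j hj => ?_
        rw [(mem_filter.1 hj).2]
    have hsum := key id
    have hcard := card_filter_add_card_filter_not (s := A) (fun j => f j = c)
    simp only [id] at hsum
    rw [hs, hc, Nat.choose_two_right] at hsum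
    have : 2 * c * (2 * c - 1) / 2 = c * (2 * c - 1) := by
      rw [mul_assoc, Nat.mul_div_cancel_left _ (by norm_num)]
    rw [this] at hsum
    rw [hc] at hcard
    rw [key g]
    generalize (A.filter fun j => ¬ f j = c).card = x at *
    generalize (A.filter fun j => f j = c).card = y at *
    obtain ⟨c, rfl⟩ : ∃ a, c = a + 1 := ⟨c - 1, by omega⟩
    have e4 : 2 * (c + 1) - 1 = 2 * c + 1 := by omega
    rw [e4, Nat.add_sub_cancel] at hsum
    have hy : y = c + 1 := by
      have hx : x = 2 * (c + 1) - y := by omega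
      have : x + y = 2 * (c + 1) := by omega
      nlinarith
    have hx : x = c + 1 := by omega
    rw [hx, hy]
  · have e1 : (A.card - 1) / 2 = c := by omega
    have e2 : A.card / 2 = c := by omega
    rw [e1, e2] at hv
    rw [e1, e2, ← add_mul, Nat.sub_add_cancel (by omega), ← smul_eq_mul, ← sum_const]
    exact sum_congr rfl fun j hj => by rcases hv j hj with h | h <;> rw [h]

/-! ### Existence of placements and the size of the caches. -/

/-- For odd `K` there are `K * ((K-1)/2)` pairs, so the first coordinate of any bijection with the
product is a balanced owner map, usable for every file. -/
theorem nonempty_placement (hK : Odd K) : Nonempty (Placement K N Nh Nr) := by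
  have hc : Fintype.card (Pair K) = Fintype.card (Fin K × Fin ((K - 1) / 2)) := by
    rw [card_pairs, choose_two_of_odd hK, Fintype.card_prod, Fintype.card_fin, Fintype.card_fin]
  let e : Pair K ≃ Fin K × Fin ((K - 1) / 2) := Fintype.equivOfCardEq hc
  refine ⟨⟨fun _ s => (e s).1, fun _ _ u => ?_⟩⟩
  rw [← card_map e.toEmbedding]
  have : (univ.filter fun s : Pair K => (e s).1 = u).map e.toEmbedding = {u} ×ˢ univ := by
    ext ⟨a, c⟩
    simp only [mem_map_equiv, mem_filter, mem_univ, true_and, Equiv.apply_symm_apply, mem_product,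
      mem_singleton, and_true]
  rw [this, card_product, card_singleton, one_mul, card_univ, Fintype.card_fin]

theorem card_pairs_through (u : Fin K) :
    (univ.filter fun s : Pair K => u ∈ s.1).card = K - 1 := by
  have : (univ.erase u).card = K - 1 := by rw [card_erase_of_mem (mem_univ u), card_univ,
    Fintype.card_fin]
  rw [← this]
  refine (card_bij (fun a ha => (⟨{u, a}, card_pair (ne_of_mem_erase ha).symm⟩ : Pair K))
    ?_ ?_ ?_).symm
  · intro a ha
    simp
  · intro a ha c hc h
    have h1 : a ∈ ({u, c} : Finset (Fin K)) := by
      rw [← Subtype.mk.inj h]; simp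
    rcases mem_insert.1 h1 with h2 | h2
    · exact absurd h2 (ne_of_mem_erase ha)
    · exact mem_singleton.1 h2
  · intro s hs
    obtain ⟨c, hcu, hc⟩ := exists_pair_eq s (mem_filter.1 hs).2
    exact ⟨c, mem_erase.2 ⟨hcu, mem_univ _⟩, Subtype.ext hc.symm⟩

theorem card_isHigh (hN : Nh ≤ N) : (univ.filter fun n : Fin N => IsHigh Nh n).card = Nh := by
  have : (univ.filter fun n : Fin N => IsHigh Nh n) = univ.filter fun n : Fin N => n.val < Nh :=
    filter_congr fun n _ => Iff.rfl
  rw [this, Fin.card_filter_val_lt, min_eq_right hN]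

theorem card_isZero (hN : Nr ≤ N) : (univ.filter fun n : Fin N => IsZero Nr n).card = Nr := by
  have h := card_filter_add_card_filter_not (s := (univ : Finset (Fin N))) (fun n => n.val < N - Nr)
  rw [Fin.card_filter_val_lt, card_univ, Fintype.card_fin] at h
  have : (univ.filter fun n : Fin N => IsZero Nr n) =
      univ.filter fun n : Fin N => ¬ n.val < N - Nr := by
    refine filter_congr fun n _ => ?_
    unfold IsZero
    omega
  rw [this]
  omega

theorem card_isLow (hN : Nh + Nr ≤ N) :
    (univ.filter fun n : Fin N => IsLow Nh Nr n).card = N - Nh - Nr := by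
  have hd : Disjoint (univ.filter fun n : Fin N => IsHigh Nh n)
      (univ.filter fun n : Fin N => IsZero Nr n) :=
    disjoint_filter.2 fun n _ h => not_isZero_of_isHigh hN h
  have h : (univ.filter fun n : Fin N => IsLow Nh Nr n) =
      ((univ.filter fun n : Fin N => IsHigh Nh n) ∪ univ.filter fun n : Fin N => IsZero Nr n)ᶜ := by
    ext n
    rw [mem_filter]
    simp [IsLow]
  rw [h, card_compl, card_union_of_disjoint hd, card_isHigh (by omega), card_isZero (by omega),
    Fintype.card_fin, Nat.sub_sub]

theorem Placement.card_cache (P : Placement K N Nh Nr) (hN : Nh + Nr ≤ N) (u : Fin K) :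
    (P.cache u).card = Nh * (K - 1) + (N - Nh - Nr) * ((K - 1) / 2) := by
  have h : (P.cache u).card = ∑ n : Fin N, (univ.filter fun s : Pair K => P.Caches u (n, s)).card := by
    rw [Placement.cache, card_filter, Fintype.sum_prod_type]
    exact sum_congr rfl fun n _ => (card_filter _ _).symm
  have hn : ∀ n : Fin N, (univ.filter fun s : Pair K => P.Caches u (n, s)).card =
      (if IsHigh Nh n then K - 1 else 0) + (if IsLow Nh Nr n then (K - 1) / 2 else 0) := by
    intro n
    by_cases h1 : IsHigh Nh n
    · have h2 : ¬ IsLow Nh Nr n := fun h => h.1 h1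
      rw [if_pos h1, if_neg h2, add_zero, ← card_pairs_through u]
      congr 1
      ext s
      simp [Placement.Caches, h1, h2]
    · rw [if_neg h1, zero_add]
      split_ifs with h2
      · rw [← P.balanced n h2 u]
        congr 1
        ext s
        simp [Placement.Caches, h1, h2]
      · rw [card_eq_zero]
        ext s
        simp [Placement.Caches, h1, h2]
  rw [h, sum_congr rfl fun n _ => hn n, sum_add_distrib, ← sum_filter, ← sum_filter, sum_const,
    sum_const, card_isHigh (by omega), card_isLow hN, smul_eq_mul, smul_eq_mul]

theorem Placement.cache_bits (P : Placement K N Nh Nr) (hK : Odd K) (hN : Nh + Nr ≤ N) (b : ℕ)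
    (u : Fin K) :
    (((P.cache u).card * b : ℕ) : ℚ) = cacheSize K N Nh Nr * (fileSize K b : ℚ) := by
  rw [P.card_cache hN, cacheSize, fileSize, choose_two_of_odd hK]
  obtain ⟨c, rfl⟩ := hK
  have h1 : 2 * c + 1 - 1 = 2 * c := by omega
  have h2 : 2 * c / 2 = c := by omega
  rw [h1, h2, Nat.sub_sub]
  push_cast [Nat.cast_sub hN]
  have : (2 * (c : ℚ) + 1) ≠ 0 := by positivity
  field_simp
  ring

/-! ### Sizes of the delivery sets and number of messages. -/

namespace Delivery

variable {P : Placement K N Nh Nr} {d : Fin K → Fin N} (D : Delivery P d) {i j : Fin K}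

theorem sum_card_Lam (hi : i ∈ Kh Nh d) :
    ∑ j ∈ Kl Nh Nr d, (D.Lam i j).card = (Kl Nh Nr d).card.choose 2 := by
  rw [← card_setLambda, ← D.Lam_cover i hi, card_biUnion]
  exact fun j hj k hk => D.Lam_disjoint i hi j hj k hk

theorem card_Lam (hi : i ∈ Kh Nh d) (hj : j ∈ Kl Nh Nr d) :
    (D.Lam i j).card = ((Kl Nh Nr d).card - 1) / 2 ∨ (D.Lam i j).card = (Kl Nh Nr d).card / 2 :=
  uniform_values (f := fun j => (D.Lam i j).card) (D.Lam_uniform i hi) (D.sum_card_Lam hi) hj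

theorem sum_Lam (hi : i ∈ Kh Nh d) (g : ℕ → ℕ) :
    ∑ j ∈ Kl Nh Nr d, g (D.Lam i j).card =
      ((Kl Nh Nr d).card - (Kl Nh Nr d).card / 2) * g (((Kl Nh Nr d).card - 1) / 2) +
        (Kl Nh Nr d).card / 2 * g ((Kl Nh Nr d).card / 2) :=
  sum_uniform (f := fun j => (D.Lam i j).card) (D.Lam_uniform i hi) (D.sum_card_Lam hi) g

theorem Lam_subset_setLambda (hi : i ∈ Kh Nh d) (hj : j ∈ Kl Nh Nr d) :
    D.Lam i j ⊆ setLambda Nh Nr d := by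
  rw [← D.Lam_cover i hi]
  exact subset_biUnion_of_mem (D.Lam i) hj

theorem sigma_eq (hN : Nh + Nr ≤ N) (hi : i ∈ Kh Nh d) (hj : j ∈ Kl Nh Nr d) :
    D.sigma i j = sigmaOf (D.Lam i j).card (Kr Nr d).card ((K - 1) / 2) := by
  rw [sigma, card_setZ hN hi hj, card_setH hj]

theorem n_eq (hN : Nh + Nr ≤ N) (hi : i ∈ Kh Nh d) (hj : j ∈ Kl Nh Nr d) :
    D.n i j = nOf ((Kh Nh d).card - 1) (D.Lam i j).card (Kr Nr d).card ((K - 1) / 2) := by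
  rw [n, card_setZ hN hi hj, card_setH hj, card_setOmega hi hj]

end Delivery

/-- The three constituents of `F_{i,j}` are disjoint. -/
theorem card_union_levels {d : Fin K → Fin N} (hN : Nh + Nr ≤ N) {i j : Fin K}
    {L Q O : Finset (Pair K)} (hj : j ∈ Kl Nh Nr d)
    (hL : L ⊆ setLambda Nh Nr d) (hQ : Q ⊆ setZ Nr d i j)
    (hO : O ⊆ setOmega Nh d i j) : (L ∪ Q ∪ O).card = L.card + Q.card + O.card := by
  have hLQ : Disjoint L Q := disjoint_left.2 fun s h h' => by
    obtain ⟨-, k, hk, hks⟩ := mem_setZ.1 (hQ h')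
    exact disjoint_left.1 (disjoint_Kr_Kl d) hk (mem_setLambda.1 (hL h) hks)
  have hLO : Disjoint L O := disjoint_left.2 fun s h h' => by
    obtain ⟨-, k, hk, hks⟩ := mem_setOmega.1 (hO h')
    exact disjoint_left.1 (disjoint_Kh_Kl d) hk (mem_setLambda.1 (hL h) hks)
  have hQO : Disjoint Q O := disjoint_left.2 fun s h h' => by
    obtain ⟨-, k, hk, hks⟩ := mem_setOmega.1 (hO h')
    obtain ⟨⟨-, hjs⟩, r, hr, hrs⟩ := mem_setZ.1 (hQ h)
    rw [pair_eq_of_mem hks hjs (ne_of_mem_Kh_of_mem_Kl hk hj)] at hrs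
    rcases mem_insert.1 hrs with rfl | hrs
    · exact disjoint_left.1 (disjoint_Kh_Kr hN d) hk hr
    · rw [mem_singleton.1 hrs] at hr
      exact disjoint_left.1 (disjoint_Kr_Kl d) hr hj
  rw [card_union_of_disjoint (disjoint_union_left.2 ⟨hLO, hQO⟩), card_union_of_disjoint hLQ]

namespace Delivery

variable {P : Placement K N Nh Nr} {d : Fin K → Fin N} (D : Delivery P d) {i j : Fin K}

/-- If `|Λ| + kr ≥ |H|`, then `σ` removes exactly the excess and all of `Ω` goes to `Δ`. Otherwise
`Ω` must fill the gap `|H| - |Λ| - kr`, so this gap must not exceed `kh - 1`. From `2|H| = kh + kl +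
kr - 1` and `2|Λ| ≥ kl - 2`, twice the gap is at most `kh - kr + 1`, which suffices if `kh + kr ≥
3`. If `kh + kr = 2`, then `kl` is odd, `2|Λ| = kl - 1`, and the bound improves to `kh - kr`. -/
theorem card_F (hK : Odd K) (hN : Nh + Nr ≤ N) (hi : i ∈ Kh Nh d) (hj : j ∈ Kl Nh Nr d)
    (h : ¬ ((Kh Nh d).card = 1 ∧ (Kr Nr d).card = 0)) :
    (D.F i j).card = (setH P d i j).card := by
  have h1 := D.Pi_card i hi j hj
  have h2 := D.Del_card i hi j hj
  rw [F, card_union_levels hN hj (D.Lam_subset_setLambda hi hj) (D.Pi_subset i hi j hj) sdiff_subset,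
    card_sdiff_of_subset (D.Del_subset i hi j hj)]
  rw [card_sdiff_of_subset (D.Pi_subset i hi j hj)] at h1
  have h3 := card_le_card (D.Pi_subset i hi j hj)
  have h4 := D.card_Lam hi hj
  have h5 := card_levels hN d
  have h6 := card_pos.2 ⟨i, hi⟩
  have h7 := card_pos.2 ⟨j, hj⟩
  rw [card_setH hj, card_setZ hN hi hj] at h1
  rw [card_setH hj, card_setZ hN hi hj, card_setOmega hi hj] at h2
  rw [card_setZ hN hi hj] at h3
  rw [card_setH hj, card_setOmega hi hj]
  obtain ⟨c, hc⟩ := hK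
  unfold sigmaOf at h1
  unfold nOf at h2
  omega

theorem card_step1 (hN : Nh + Nr ≤ N) : D.step1.card =
    ((Kh Nh d).card + (Kr Nr d).card).choose 3 - (Kr Nr d).card.choose 3 := by
  have h : D.step1 = powersetCard 3 (Kh Nh d ∪ Kr Nr d) \ powersetCard 3 (Kr Nr d) := by
    ext S
    simp only [step1, mem_filter, mem_powersetCard, mem_sdiff]
    tauto
  rw [h, card_sdiff_of_subset (powersetCard_mono subset_union_right), card_powersetCard,
    card_powersetCard, card_union_of_disjoint (disjoint_Kh_Kr hN d)]

end Delivery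

theorem card_filter_lt_pairs {α : Type*} [LinearOrder α] (A : Finset α) :
    ((A ×ˢ A).filter fun x => x.1 < x.2).card = A.card.choose 2 := by
  have h1 : (A.offDiag.filter fun x => x.1 < x.2) = (A ×ˢ A).filter fun x => x.1 < x.2 := by
    ext x
    simp only [mem_filter, mem_offDiag, mem_product]
    exact ⟨fun ⟨⟨a, b, _⟩, c⟩ => ⟨⟨a, b⟩, c⟩, fun ⟨⟨a, b⟩, c⟩ => ⟨⟨a, b, c.ne⟩, c⟩⟩
  have h2 : (A.offDiag.filter fun x => ¬ x.1 < x.2).card =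
      (A.offDiag.filter fun x => x.1 < x.2).card := by
    refine card_bij' (fun x _ => x.swap) (fun x _ => x.swap) ?_ ?_ (by simp) (by simp)
    · intro x hx
      simp only [mem_filter, mem_offDiag, Prod.fst_swap, Prod.snd_swap, not_lt] at hx ⊢
      exact ⟨⟨hx.1.2.1, hx.1.1, hx.1.2.2.symm⟩, lt_of_le_of_ne hx.2 hx.1.2.2.symm⟩
    · intro x hx
      simp only [mem_filter, mem_offDiag, Prod.fst_swap, Prod.snd_swap, not_lt] at hx ⊢
      exact ⟨⟨hx.1.2.1, hx.1.1, hx.1.2.2.symm⟩, hx.2.le⟩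
  have h3 := card_filter_add_card_filter_not (s := A.offDiag) (fun x => x.1 < x.2)
  rw [h2, offDiag_card, ← Nat.mul_sub_one] at h3
  rw [← h1, Nat.choose_two_right]
  omega

/-- Counting triples by their first two components. -/
theorem card_filter_triples {α β γ : Type*} [Fintype α] [Fintype β] [Fintype γ] [DecidableEq α]
    [DecidableEq β] (A : Finset (α × β)) (S : α → β → Finset γ) (T : Finset (α × β × γ))
    (hT : ∀ x, x ∈ T ↔ (x.1, x.2.1) ∈ A ∧ x.2.2 ∈ S x.1 x.2.1) :
    T.card = ∑ p ∈ A, (S p.1 p.2).card := by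
  rw [← card_sigma]
  refine card_bij' (fun x _ => (⟨(x.1, x.2.1), x.2.2⟩ : Σ _ : α × β, γ))
    (fun y _ => (y.1.1, y.1.2, y.2)) ?_ ?_ (fun _ _ => rfl) (fun _ _ => rfl)
  · intro x hx
    exact mem_sigma.2 ((hT x).1 hx)
  · intro y hy
    exact (hT _).2 (mem_sigma.1 hy)

theorem card_filter_tagged {α γ : Type*} [Fintype α] [Fintype γ]
    (A : Finset α) (S : α → Finset γ) (T : Finset (α × γ))
    (hT : ∀ x, x ∈ T ↔ x.1 ∈ A ∧ x.2 ∈ S x.1) : T.card = ∑ p ∈ A, (S p).card := by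
  rw [← card_sigma]
  refine card_bij' (fun x _ => (⟨x.1, x.2⟩ : Σ _ : α, γ))
    (fun y _ => (y.1, y.2)) ?_ ?_ (fun _ _ => rfl) (fun _ _ => rfl)
  · intro x hx
    exact mem_sigma.2 ((hT x).1 hx)
  · intro y hy
    exact (hT _).2 (mem_sigma.1 hy)

/-- A partition into sets of two elements and at most one singleton. -/
theorem card_parts_pairing {α : Type*} [DecidableEq α] {X : Finset α} (B : Finpartition X)
    (h : ∀ p ∈ B.parts, p.card = 1 ∨ p.card = 2)
    (h1 : (B.parts.filter fun p => p.card = 1).card ≤ 1) :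
    B.parts.card = ⌈(X.card : ℚ) / 2⌉₊ := by
  have hs := B.sum_card_parts
  have hc := card_filter_add_card_filter_not (s := B.parts) (fun p => p.card = 1)
  rw [← sum_filter_add_sum_filter_not B.parts (fun p => p.card = 1),
    sum_congr rfl (g := fun _ => 1) (fun p hp => (mem_filter.1 hp).2),
    sum_congr (s₁ := B.parts.filter fun p => ¬ p.card = 1) rfl (g := fun _ => 2)
      (fun p hp => (h p (mem_filter.1 hp).1).resolve_left (mem_filter.1 hp).2),
    sum_const, sum_const, smul_eq_mul, smul_eq_mul] at hs
  -- `Nat.ceil_eq_iff` requires a nonzero value, so the empty partition is treated separately.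
  rcases Nat.eq_zero_or_pos B.parts.card with h0 | h0
  · have : X.card = 0 := by omega
    rw [h0, this]
    simp
  · symm
    rw [Nat.ceil_eq_iff (by omega)]
    generalize (B.parts.filter fun p => p.card = 1).card = x at *
    generalize (B.parts.filter fun p => ¬ p.card = 1).card = y at *
    have e1 : 2 * (B.parts.card - 1) < X.card := by omega
    have e2 : X.card ≤ 2 * B.parts.card := by omega
    constructor
    · have : (2 : ℚ) * ((B.parts.card - 1 : ℕ) : ℚ) < X.card := by exact_mod_cast e1
      linarith
    · have : (X.card : ℚ) ≤ 2 * (B.parts.card : ℚ) := by exact_mod_cast e2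
      linarith

/-- The high-level sub-files in a family of subsets of the `Ω_{i,j}`, tagged by the requesting
user `i`: no repetition occurs when `j` varies. -/
theorem card_tagged_Omega {d : Fin K → Fin N} (E : Fin K → Fin K → Finset (Pair K))
    (hE : ∀ i ∈ Kh Nh d, ∀ j ∈ Kl Nh Nr d, E i j ⊆ setOmega Nh d i j) :
    (univ.filter fun x : Fin K × Pair K =>
      x.1 ∈ Kh Nh d ∧ ∃ j ∈ Kl Nh Nr d, x.2 ∈ E x.1 j).card =
      ∑ i ∈ Kh Nh d, ∑ j ∈ Kl Nh Nr d, (E i j).card := by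
  rw [card_filter_tagged (Kh Nh d) (fun i => (Kl Nh Nr d).biUnion (E i)) _
    fun x => by simp only [mem_filter, mem_univ, true_and, mem_biUnion]]
  refine sum_congr rfl fun i hi => card_biUnion fun j hj k hk hjk => disjoint_left.2 fun s h h' => ?_
  exact hjk (setOmega_unique_low (hE i hi j hj h) hj hk (mem_setOmega.1 (hE i hi k hk h')).1.2)

namespace Delivery

variable {P : Placement K N Nh Nr} {d : Fin K → Fin N} (D : Delivery P d) {i j : Fin K}

theorem card_step2 : D.step2.card = (K - 1) / 2 * (Kl Nh Nr d).card.choose 2 := by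
  rw [card_filter_triples ((Kl Nh Nr d ×ˢ Kl Nh Nr d).filter fun x => x.1 < x.2)
    (fun j k => setH P d k j) D.step2, ← card_filter_lt_pairs, mul_comm, ← smul_eq_mul, ← sum_const]
  · exact sum_congr rfl fun x hx => card_setH (mem_product.1 (mem_filter.1 hx).1).1 _
  · intro x
    simp only [step2, mem_filter, mem_univ, true_and, mem_product, and_assoc]

theorem card_step3 :
    D.step3.card = (K - 1) / 2 * ((Kh Nh d).card * (Kl Nh Nr d).card) := by
  rw [card_filter_triples (Kh Nh d ×ˢ Kl Nh Nr d) (fun i j => setH P d i j) D.step3,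
    ← card_product, mul_comm, ← smul_eq_mul, ← sum_const]
  · exact sum_congr rfl fun x hx => card_setH (mem_product.1 hx).2 _
  · intro x
    simp only [step3, mem_filter, mem_univ, true_and, mem_product, and_assoc]

theorem mem_tagged {x : Fin K × Pair K} {p : Finset (Fin K × Pair K)} (hp : p ∈ D.B.parts)
    (hx : x ∈ p) : x.1 ∈ Kh Nh d ∧ ∃ j ∈ Kl Nh Nr d, x.2 ∈ D.Del x.1 j := by
  simpa using D.B.le hp hx

theorem card_step4 : D.step4.card =
    ⌈((∑ i ∈ Kh Nh d, ∑ j ∈ Kl Nh Nr d, D.n i j : ℕ) : ℚ) / 2⌉₊ := by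
  rw [step4, card_parts_pairing D.B _ D.B_single, card_tagged_Omega D.Del D.Del_subset,
    sum_congr rfl fun i hi => sum_congr rfl fun j hj => D.Del_card i hi j hj]
  · rfl
  · intro p hp
    refine (D.B_parts p hp).imp_right ?_
    rintro ⟨i, k, s, t, hik, -, -, rfl⟩
    exact card_pair fun h => hik (congrArg Prod.fst h)

theorem card_step5low :
    D.step5low.card = (Kl Nh Nr d).card * (Kr Nr d).card * ((K - 1) / 2) := by
  rw [card_filter_tagged (Kl Nh Nr d) (fun j => (Kr Nr d).biUnion fun r => setH P d r j) D.step5low,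
    mul_assoc, ← smul_eq_mul, ← sum_const]
  · refine sum_congr rfl fun j hj => ?_
    rw [card_biUnion, sum_congr rfl fun r _ => card_setH hj r, sum_const, smul_eq_mul]
    intro r _ r' _ hr
    exact disjoint_left.2 fun s h h' => hr ((mem_setH.1 h).symm.trans (mem_setH.1 h'))
  · intro x
    simp [step5low, mem_setH]

theorem card_step5high :
    D.step5high.card = ∑ i ∈ Kh Nh d, ∑ j ∈ Kl Nh Nr d, D.sigma i j := by
  rw [card_filter_triples (Kh Nh d ×ˢ Kl Nh Nr d) (fun i j => setZ Nr d i j \ D.Pi i j) D.step5high,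
    sum_product]
  · exact sum_congr rfl fun i hi => sum_congr rfl fun j hj => D.Pi_card i hi j hj
  · intro x
    simp only [step5high, mem_filter, mem_univ, true_and, mem_product, and_assoc]

theorem card_step5zero : D.step5zero.card = (Kr Nr d).card * K.choose 2 := by
  rw [card_filter_tagged (Kr Nr d) (fun _ => univ) D.step5zero, sum_const, card_univ, card_pairs,
    smul_eq_mul]
  intro x
  simp [step5zero]

theorem sum_sigma (hN : Nh + Nr ≤ N) : ∑ i ∈ Kh Nh d, ∑ j ∈ Kl Nh Nr d, D.sigma i j =
    sigmaSum K (Kh Nh d).card (Kl Nh Nr d).card (Kr Nr d).card := by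
  rw [sigmaSum, ← smul_eq_mul, ← sum_const]
  refine sum_congr rfl fun i hi => ?_
  rw [sum_congr rfl fun j hj => D.sigma_eq hN hi hj]
  exact D.sum_Lam hi fun x => sigmaOf x (Kr Nr d).card ((K - 1) / 2)

theorem sum_n (hN : Nh + Nr ≤ N) : ∑ i ∈ Kh Nh d, ∑ j ∈ Kl Nh Nr d, D.n i j =
    nSum K (Kh Nh d).card (Kl Nh Nr d).card (Kr Nr d).card := by
  rw [nSum, ← smul_eq_mul, ← sum_const]
  refine sum_congr rfl fun i hi => ?_
  rw [sum_congr rfl fun j hj => D.n_eq hN hi hj]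
  exact D.sum_Lam hi fun x => nOf ((Kh Nh d).card - 1) x (Kr Nr d).card ((K - 1) / 2)

theorem card_steps (hN : Nh + Nr ≤ N) :
    D.step1.card + D.step2.card + D.step3.card + D.step4.card +
      (D.step5low.card + D.step5high.card) =
      NT K (Kh Nh d).card (Kl Nh Nr d).card (Kr Nr d).card := by
  rw [D.card_step1 hN, D.card_step2, D.card_step3, D.card_step4, D.card_step5low, D.card_step5high,
    D.sum_sigma hN, D.sum_n hN, NT]

theorem rate_eq (hK3 : 3 ≤ K) (hN : Nh + Nr ≤ N) {b : ℕ} (hb : 0 < b) :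
    D.rate b = (NT K (Kh Nh d).card (Kl Nh Nr d).card (Kr Nr d).card : ℚ) / (K.choose 2 : ℚ) +
      ((Kr Nr d).card : ℚ) := by
  have h : Fintype.card D.Index = NT K (Kh Nh d).card (Kl Nh Nr d).card (Kr Nr d).card +
      (Kr Nr d).card * K.choose 2 := by
    rw [← D.card_steps hN, ← D.card_step5zero]
    simp only [Index, Fintype.card_sum, Fintype.card_coe]
    ring
  have hb' : (b : ℚ) ≠ 0 := by exact_mod_cast hb.ne'
  have hc : (K.choose 2 : ℚ) ≠ 0 := by
    exact_mod_cast (Nat.choose_pos (by omega : 2 ≤ K)).ne'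
  rw [rate, fileSize, h]
  push_cast
  field_simp

end Delivery

/-! ### Decoding. -/

namespace Delivery

variable {P : Placement K N Nh Nr} {d : Fin K → Fin N} (D : Delivery P d) {u i j : Fin K}

/-- The sub-file `x` is determined by the messages and the cache of `u`. The scheme being linear, it
is enough to look at libraries for which all of these vanish. -/
def Determined (b : ℕ) (u : Fin K) (x : SubFile K N) : Prop :=
  ∀ V : Library K N b, (∀ m, D.transmit V m = 0) → (∀ y, P.Caches u y → V y.1 y.2 = 0) →
    V x.1 x.2 = 0

/-- Two libraries with the same messages and cache contents differ by one for which all of these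
vanish. Hence the requested file factors through the observations, and such a factorization is a
decoder. -/
theorem decodable_of_determined {b : ℕ} (h : ∀ u s, D.Determined b u (d u, s)) :
    D.Decodable b := by
  classical
  intro u
  let obs : Library K N b → (D.Index → Bits b) × (P.cache u → Bits b) :=
    fun W => (D.transmit W, fun x => W x.1.1 x.1.2)
  have hf : Function.FactorsThrough (fun W : Library K N b => W (d u)) obs := by
    intro W W' hW
    have h1 := congrArg Prod.fst hW
    have h2 := congrArg Prod.snd hW
    funext s
    have := h u s (W - W') (fun m => ?_) (fun y hy => ?_)
    · exact sub_eq_zero.1 this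
    · have := congrFun h1 m
      simp only [obs, transmit] at this ⊢
      simp only [Pi.sub_apply, sum_sub_distrib]
      exact sub_eq_zero.2 this
    · have := congrFun h2 ⟨y, mem_filter.2 ⟨mem_univ _, hy⟩⟩
      exact sub_eq_zero.2 this
  -- The default `0` is attained only at observations that come from no library.
  refine ⟨fun m c => Function.extend obs (fun W => W (d u)) (fun _ => 0) (m, c), fun W => ?_⟩
  exact hf.extend_apply (fun _ => 0) W

theorem determined_of_caches {b : ℕ} {x : SubFile K N} (h : P.Caches u x) :
    D.Determined b u x :=
  fun _ _ hV => hV x h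

/-- A sub-file can be read off a message if the other sub-files of the message are cached. -/
theorem determined_of_msg {b : ℕ} {x : SubFile K N} (m : D.Index) (hx : x ∈ D.msg m)
    (h : ∀ y ∈ D.msg m, y ≠ x → P.Caches u y) : D.Determined b u x := by
  intro V hm hV
  have := hm m
  rwa [transmit, sum_eq_single_of_mem x hx fun y hy hyx => hV y (h y hy hyx)] at this

theorem determined_zero {b : ℕ} (hu : u ∈ Kr Nr d) (s : Pair K) : D.Determined b u (d u, s) := by
  refine D.determined_of_msg
    (.inr (.inr (.inr (.inr (.inr (.inr ⟨(u, s), by simpa [step5zero] using hu⟩)))))) ?_ ?_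
  · simp [msg]
  · intro y hy hyx
    exact absurd (mem_singleton.1 hy) hyx

theorem caches_of_owner (hj : j ∈ Kl Nh Nr d) {s : Pair K} (h : s ∈ setH P d u j) :
    P.Caches u (d j, s) :=
  Or.inr ⟨mem_Kl.1 hj, mem_setH.1 h⟩

theorem caches_of_mem (hi : i ∈ Kh Nh d) {s : Pair K} (h : u ∈ s.1) : P.Caches u (d i, s) :=
  Or.inl ⟨mem_Kh.1 hi, h⟩

theorem F_subset_setL (hi : i ∈ Kh Nh d) (hj : j ∈ Kl Nh Nr d) : D.F i j ⊆ setL i j := by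
  refine union_subset (union_subset (D.Lam_subset i hi j hj) ?_) ?_
  · exact (D.Pi_subset i hi j hj).trans (filter_subset _ _)
  · exact sdiff_subset.trans (filter_subset _ _)

/-- The level of the owner of `s` selects the step: Step 3 for a high-level owner, Step 2 (or the
own cache) for a low-level one, a unicast for a zero-level one. -/
theorem determined_low {b : ℕ} (hu : u ∈ Kl Nh Nr d) (s : Pair K) :
    D.Determined b u (d u, s) := by
  rcases level_cases Nh Nr d (P.owner (d u) s) with ho | ho | ho
  · refine D.determined_of_msg (.inr (.inr (.inl ⟨(P.owner (d u) s, u, s),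
      by simp [step3, ho, hu, mem_setH]⟩))) (mem_insert_self _ _) ?_
    intro y hy hyx
    rcases mem_insert.1 hy with rfl | hy
    · exact absurd rfl hyx
    · obtain ⟨t, ht, rfl⟩ := mem_image.1 hy
      exact caches_of_mem ho (mem_setL.1 (D.F_subset_setL ho hu (mem_filter.1 ht).1)).2
  · generalize hk : P.owner (d u) s = k at ho
    have hs : s ∈ setH P d k u := mem_setH.2 hk
    rcases lt_trichotomy u k with h | rfl | h
    · refine D.determined_of_msg (.inr (.inl ⟨(u, k, s), by simp [step2, ho, hu, h, hs]⟩))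
        (mem_insert_self _ _) ?_
      intro y hy hyx
      rcases mem_insert.1 hy with rfl | hy
      · exact absurd rfl hyx
      · rw [mem_singleton.1 hy]
        exact caches_of_owner ho ((D.lowPair_bij u hu k ho h).mapsTo hs)
    · exact D.determined_of_caches (caches_of_owner hu hs)
    -- Here `u` is the larger user of the pair, so `s` occurs as a partner; surjectivity of the
    -- matching supplies the sub-file it is XORed with.
    · obtain ⟨t, ht, rfl⟩ := (D.lowPair_bij k ho u hu h).surjOn hs
      refine D.determined_of_msg (.inr (.inl ⟨(k, u, t), by
        simpa [step2, ho, hu, h] using ht⟩)) (mem_insert_of_mem (mem_singleton_self _)) ?_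
      intro y hy hyx
      rcases mem_insert.1 hy with rfl | hy
      · exact caches_of_owner ho ht
      · exact absurd (mem_singleton.1 hy) hyx
  · refine D.determined_of_msg
      (.inr (.inr (.inr (.inr (.inl ⟨(u, s), by simp [step5low, hu, ho]⟩))))) ?_ ?_
    · simp [msg]
    · intro y hy hyx
      exact absurd (mem_singleton.1 hy) hyx

/-- Injectivity of `cross` makes `s` the only member of `F_{u,j}` in its message, and the low-level
term is in `H_{u,j}`, hence cached by `u`. -/
theorem determined_of_mem_F {b : ℕ} (hu : u ∈ Kh Nh d) (hj : j ∈ Kl Nh Nr d) {s : Pair K}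
    (hs : s ∈ D.F u j) : D.Determined b u (d u, s) := by
  have hc := D.cross_maps u hu j hj s hs
  refine D.determined_of_msg (.inr (.inr (.inl ⟨(u, j, D.cross u j s),
    by simp [step3, hu, hj, hc]⟩)))
    (mem_insert_of_mem (mem_image.2 ⟨s, mem_filter.2 ⟨hs, rfl⟩, rfl⟩)) ?_
  intro y hy hyx
  rcases mem_insert.1 hy with rfl | hy
  · exact caches_of_owner hj hc
  · obtain ⟨t, ht, rfl⟩ := mem_image.1 hy
    rw [mem_filter] at ht
    exact absurd (congrArg (Prod.mk (d u))
      (D.cross_inj u hu j hj (mem_coe.2 ht.1) (mem_coe.2 hs) ht.2)) hyx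

theorem determined_of_mem_Del {b : ℕ} (hu : u ∈ Kh Nh d) (hj : j ∈ Kl Nh Nr d) {s : Pair K}
    (hs : s ∈ D.Del u j) : D.Determined b u (d u, s) := by
  obtain ⟨p, hp, hx⟩ := D.B.exists_mem (a := (u, s)) (by simpa [hu] using ⟨j, hj, hs⟩)
  refine D.determined_of_msg (.inr (.inr (.inr (.inl ⟨p, hp⟩))))
    (mem_image.2 ⟨(u, s), hx, rfl⟩) ?_
  intro y hy hyx
  obtain ⟨z, hz, rfl⟩ := mem_image.1 hy
  refine caches_of_mem (D.mem_tagged hp hz).1 ?_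
  rcases D.B_parts p hp with h1 | ⟨i, k, t, t', hik, hi, hk, rfl⟩
  · exact absurd (by rw [card_le_one.1 h1.le z hz _ hx]) hyx
  · simp only [mem_insert, mem_singleton, Prod.mk.injEq] at hx hz
    rcases hx with ⟨rfl, rfl⟩ | ⟨rfl, rfl⟩ <;> rcases hz with rfl | rfl
    · exact absurd rfl hyx
    · exact hi
    · exact hk
    · exact absurd rfl hyx

/-- In the Step 1 message for `S = {u} ∪ s`, every term other than the wanted one has an index
containing `u`. -/
theorem determined_of_subset {b : ℕ} (hu : u ∈ Kh Nh d) {s : Pair K} (hus : u ∉ s.1)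
    (hN : Nh + Nr ≤ N)
    (hs : s.1 ⊆ Kh Nh d ∪ Kr Nr d) : D.Determined b u (d u, s) := by
  refine D.determined_of_msg (.inl ⟨insert u s.1, ?_⟩) ?_ ?_
  · rw [step1, mem_filter, mem_powersetCard, card_insert_of_notMem hus, s.2]
    refine ⟨⟨insert_subset (mem_union_left _ hu) hs, rfl⟩, fun h => ?_⟩
    exact disjoint_left.1 (disjoint_Kh_Kr hN d) hu (h (mem_insert_self _ _))
  · simp only [msg, msg1, mem_filter, mem_univ, true_and]
    exact ⟨u, mem_insert_self _ _, hu, rfl, (erase_insert hus).symm⟩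
  · rintro ⟨y1, y2⟩ hy hyx
    simp only [msg, msg1, mem_filter, mem_univ, true_and] at hy
    obtain ⟨v, hv, hvh, rfl, hy⟩ := hy
    refine caches_of_mem hvh ?_
    rw [hy]
    refine mem_erase.2 ⟨?_, mem_insert_self _ _⟩
    rintro rfl
    rw [erase_insert hus] at hy
    exact hyx (by rw [Subtype.ext hy])

/-- A pair avoiding `u` that is not covered by Step 1 contains a low-level user `j`. The level of
its other member `k` places it in `Ω_{u,j}`, in `Λ_u` or in `Z_{u,j}`. -/
theorem determined_high {b : ℕ} (hN : Nh + Nr ≤ N) (hu : u ∈ Kh Nh d) (s : Pair K) :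
    D.Determined b u (d u, s) := by
  by_cases hus : u ∈ s.1
  · exact D.determined_of_caches (caches_of_mem hu hus)
  by_cases hsl : s.1 ⊆ Kh Nh d ∪ Kr Nr d
  · exact D.determined_of_subset hu hus hN hsl
  obtain ⟨j, hjs, hj⟩ := not_subset.1 hsl
  have hj : j ∈ Kl Nh Nr d := by
    have := level_cases Nh Nr d j
    rw [mem_union] at hj
    tauto
  obtain ⟨k, hkj, hk⟩ := exists_pair_eq s hjs
  have hks : k ∈ s.1 := by simp [hk]
  rcases level_cases Nh Nr d k with h | h | h
  · have hO : s ∈ setOmega Nh d u j := mem_setOmega.2 ⟨⟨hus, hjs⟩, k, h, hks⟩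
    by_cases hD : s ∈ D.Del u j
    · exact D.determined_of_mem_Del hu hj hD
    · exact D.determined_of_mem_F hu hj (mem_union_right _ (mem_sdiff.2 ⟨hO, hD⟩))
  · have hL : s ∈ setLambda Nh Nr d := by
      rw [mem_setLambda, hk]
      exact insert_subset hj (singleton_subset_iff.2 h)
    -- Both members of `s` are low-level, and the part `Λ_{u,l}` containing it need not be the one
    -- at `j`.
    rw [← D.Lam_cover u hu] at hL
    obtain ⟨l, hl, hsl⟩ := mem_biUnion.1 hL
    exact D.determined_of_mem_F hu hl (mem_union_left _ (mem_union_left _ hsl))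
  · have hZ : s ∈ setZ Nr d u j := mem_setZ.2 ⟨⟨hus, hjs⟩, k, h, hks⟩
    by_cases hD : s ∈ D.Pi u j
    · exact D.determined_of_mem_F hu hj (mem_union_left _ (mem_union_right _ hD))
    · refine D.determined_of_msg (.inr (.inr (.inr (.inr (.inr (.inl ⟨(u, j, s), by
        simp [step5high, hu, hj, hZ, hD]⟩)))))) ?_ ?_
      · simp [msg]
      · intro y hy hyx
        exact absurd (mem_singleton.1 hy) hyx

theorem decodable (hN : Nh + Nr ≤ N) (b : ℕ) : D.Decodable b :=
  D.decodable_of_determined fun u s => by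
    rcases level_cases Nh Nr d u with h | h | h
    · exact D.determined_high hN h s
    · exact D.determined_low h s
    · exact D.determined_zero h s

end Delivery

/-! ### Labellings of finite sets and balanced tournaments. -/

theorem exists_bijOn_range {α : Type*} [DecidableEq α] (A : Finset α) :
    ∃ f : α → ℕ, Set.BijOn f A (range A.card) := by
  refine ⟨fun a => if h : a ∈ A then (A.equivFin ⟨a, h⟩).val else 0, ?_, ?_, ?_⟩
  · intro a ha
    have ha : a ∈ A := ha
    simp [ha]
  · intro a ha c hc h
    have ha : a ∈ A := ha
    have hc : c ∈ A := hc
    simp only [ha, hc, dif_pos] at h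
    exact congrArg Subtype.val (A.equivFin.injective (Fin.ext h))
  · intro n hn
    have hn : n < A.card := by simpa using hn
    refine ⟨(A.equivFin.symm ⟨n, hn⟩).1, (A.equivFin.symm ⟨n, hn⟩).2, ?_⟩
    simp

theorem exists_bijOn_range_of_ne {α : Type*} [DecidableEq α] {A : Finset α} {v x : α} (hv : v ∈ A)
    (hx : x ∈ A) (hvx : v ≠ x) {p q : ℕ} (hp : p < A.card) (hq : q < A.card) (hpq : p ≠ q) :
    ∃ f : α → ℕ, Set.BijOn f A (range A.card) ∧ f v = p ∧ f x = q := by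
  have swap_bij : ∀ {a c : ℕ}, a < A.card → c < A.card →
      Set.BijOn (Equiv.swap a c) (range A.card) (range A.card) := by
    intro a c ha hc
    have hm : Set.MapsTo (Equiv.swap a c) (range A.card : Set ℕ) (range A.card) := by
      intro n hn
      have hn : n < A.card := by simpa using hn
      simp only [coe_range, Set.mem_Iio]
      rw [Equiv.swap_apply_def]
      split_ifs <;> assumption
    refine ⟨hm, (Equiv.injective _).injOn, fun n hn => ⟨Equiv.swap a c n, hm hn, ?_⟩⟩
    exact Equiv.swap_apply_self a c n
  obtain ⟨f, hf⟩ := exists_bijOn_range A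
  have lt_of : ∀ {g : α → ℕ}, Set.BijOn g A (range A.card) → ∀ {a}, a ∈ A → g a < A.card :=
    fun hg a ha => by simpa using hg.mapsTo ha
  have h1 := (swap_bij (lt_of hf hv) hp).comp hf
  have h1v : (Equiv.swap (f v) p ∘ f) v = p := Equiv.swap_apply_left _ _
  generalize Equiv.swap (f v) p ∘ f = g at h1 h1v
  refine ⟨_, (swap_bij (lt_of h1 hx) hq).comp h1, ?_, Equiv.swap_apply_left _ _⟩
  rw [Function.comp_apply, h1v]
  -- The second swap, which moves `x` to `q`, leaves the value `p` at `v` alone because `g x ≠ p`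
  -- and `p ≠ q`.
  refine Equiv.swap_apply_of_ne_of_ne (fun h => hvx ?_) hpq
  exact h1.injOn hv hx (h1v.trans h)

theorem card_filter_bijOn {α : Type*} [DecidableEq α] {A : Finset α} {f : α → ℕ} {m : ℕ}
    (hf : Set.BijOn f A (range m)) (Q : ℕ → Prop) [DecidablePred Q] :
    (A.filter fun a => Q (f a)).card = ((range m).filter Q).card := by
  refine card_bij (fun a _ => f a) ?_ ?_ ?_
  · intro a ha
    rw [mem_filter] at ha ⊢
    exact ⟨hf.mapsTo ha.1, ha.2⟩
  · intro a ha c hc h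
    exact hf.injOn (mem_filter.1 ha).1 (mem_filter.1 hc).1 h
  · intro n hn
    rw [mem_filter] at hn
    obtain ⟨a, ha, rfl⟩ := hf.surjOn hn.1
    exact ⟨a, mem_filter.2 ⟨ha, hn.2⟩, rfl⟩

/-- The rotational tournament on `m` points of a circle: `a` beats the points less than half a turn
ahead. For even `m`, the smaller of two antipodal points wins, whence the two possible out-degrees.
-/
theorem card_filter_tournament {m a : ℕ} (ha : a < m) :
    ((range m).filter fun c => (a < c ∧ c ≤ a + m / 2) ∨ (c < a ∧ c + m / 2 < a)).card =
        (m - 1) / 2 ∨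
      ((range m).filter fun c => (a < c ∧ c ≤ a + m / 2) ∨ (c < a ∧ c + m / 2 < a)).card =
        m / 2 := by
  have h : ((range m).filter fun c => (a < c ∧ c ≤ a + m / 2) ∨ (c < a ∧ c + m / 2 < a)) =
      Ioc a (min (a + m / 2) (m - 1)) ∪ range (a - m / 2) := by
    ext c
    simp only [mem_filter, mem_range, mem_union, mem_Ioc, le_min_iff]
    omega
  rw [h, card_union_of_disjoint, Nat.card_Ioc, card_range]
  · omega
  · refine disjoint_left.2 fun c h h' => ?_
    simp only [mem_range, mem_Ioc] at h h'
    omega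

/-- A tournament in which the numbers of wins differ by at most one. -/
theorem exists_tournament {α : Type*} [DecidableEq α] (A : Finset α) :
    ∃ T : α → Finset α, (∀ a ∈ A, T a ⊆ A.erase a) ∧
      (∀ a ∈ A, ∀ c ∈ A, a ≠ c → (c ∈ T a ∨ a ∈ T c) ∧ ¬ (c ∈ T a ∧ a ∈ T c)) ∧
      ∀ a ∈ A, (T a).card = (A.card - 1) / 2 ∨ (T a).card = A.card / 2 := by
  obtain ⟨f, hf⟩ := exists_bijOn_range A
  refine ⟨fun a => A.filter fun c => (f a < f c ∧ f c ≤ f a + A.card / 2) ∨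
    (f c < f a ∧ f c + A.card / 2 < f a), ?_, ?_, ?_⟩
  · intro a ha c hc
    rw [mem_filter] at hc
    refine mem_erase.2 ⟨?_, hc.1⟩
    rintro rfl
    omega
  · intro a ha c hc hac
    have : f a ≠ f c := fun h => hac (hf.injOn ha hc h)
    simp only [mem_filter, ha, hc, true_and]
    omega
  · intro a ha
    have hlt : f a < A.card := by simpa using hf.mapsTo ha
    rw [card_filter_bijOn hf fun c => (f a < c ∧ c ≤ f a + A.card / 2) ∨
      (c < f a ∧ c + A.card / 2 < f a)]
    exact card_filter_tournament hlt

/-! ### Regular digraphs with at most one one-way arc. -/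

/-- Cyclic distance at most `n / 2`, and for odd `n` also the (almost) antipodal point. -/
def Arc (m n a c : ℕ) : Prop :=
  (a < c ∧ (c ≤ a + n / 2 ∨ a + m ≤ c + n / 2)) ∨ (c < a ∧ (a ≤ c + n / 2 ∨ c + m ≤ a + n / 2)) ∨
    (n % 2 = 1 ∧ ((a < m / 2 ∧ c = a + m / 2) ∨ (m / 2 ≤ a ∧ c + m / 2 = a)))

instance (m n a : ℕ) : DecidablePred (Arc m n a) := fun c => inferInstanceAs (Decidable
  ((a < c ∧ (c ≤ a + n / 2 ∨ a + m ≤ c + n / 2)) ∨ (c < a ∧ (a ≤ c + n / 2 ∨ c + m ≤ a + n / 2)) ∨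
    (n % 2 = 1 ∧ ((a < m / 2 ∧ c = a + m / 2) ∨ (m / 2 ≤ a ∧ c + m / 2 = a)))))

theorem card_filter_arc {m n a : ℕ} (hn : n < m) (ha : a < m) :
    ((range m).filter (Arc m n a)).card = n := by
  -- The points ahead of `a`, those behind `a` across `0`, those behind, those ahead across `0`, and
  -- the extra point for odd `n`. Disjointness uses `n < m`.
  have h : ((range m).filter (Arc m n a)) =
      ((Ioc a (min (a + n / 2) (m - 1)) ∪ Ico (a + m - n / 2) m) ∪
        (Ico (a - n / 2) a ∪ range (a + n / 2 + 1 - m))) ∪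
        (if n % 2 = 1 then {if a < m / 2 then a + m / 2 else a - m / 2} else ∅) := by
    ext c
    simp only [mem_filter, mem_range, mem_union, mem_Ioc, mem_Ico, le_min_iff, Arc]
    split_ifs <;> simp only [mem_singleton, notMem_empty, or_false] <;> omega
  rw [h, card_union_of_disjoint, card_union_of_disjoint, card_union_of_disjoint,
    card_union_of_disjoint, Nat.card_Ioc, Nat.card_Ico, Nat.card_Ico, card_range]
  · split_ifs <;> simp only [card_singleton, card_empty] <;> omega
  all_goals
    refine disjoint_left.2 fun c h h' => ?_
    simp only [mem_union, mem_range, mem_Ioc, mem_Ico, le_min_iff] at h h'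
  · omega
  · omega
  · omega
  · split_ifs at h' <;> simp only [mem_singleton, notMem_empty] at h' <;> omega

/-- Only the extra arcs can fail to be symmetric. For even `m` they match antipodal points. For odd
`m` they match `a` with `a + m/2` for `a < m/2`, which leaves out `m - 1`, whose extra arc goes to
the already matched point `m/2`. -/
theorem Arc.symm_or {m n a c : ℕ} (hn : n < m) (ha : a < m) (h : Arc m n a c) :
    Arc m n c a ∨ (a = m - 1 ∧ c = m / 2 ∧ m % 2 = 1 ∧ n % 2 = 1) := by
  unfold Arc at *
  omega

theorem arc_last {m n : ℕ} (hm2 : m % 2 = 1) (hn2 : n % 2 = 1) : Arc m n (m - 1) (m / 2) := by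
  unfold Arc
  omega

theorem Arc.not_reverse {m n : ℕ} (hn : n < m) (hm2 : m % 2 = 1) (hn2 : n % 2 = 1) :
    ¬ Arc m n (m / 2) (m - 1) := by
  unfold Arc
  omega

/-- A digraph on `A` in which all out-degrees are `n`, and which is symmetric, except that it
contains a single one-way arc, from `v` to `x`, if the number of arcs is odd. -/
theorem exists_regular_digraph {α : Type*} [DecidableEq α] {A : Finset α} {v x : α} {n : ℕ}
    (hn : n < A.card) (hvx : 1 < A.card → v ∈ A ∧ x ∈ A ∧ v ≠ x) :
    ∃ T : α → Finset α, (∀ a ∈ A, T a ⊆ A.erase a ∧ (T a).card = n) ∧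
      (∀ a ∈ A, ∀ c ∈ T a, a ∈ T c ∨ (Odd (A.card * n) ∧ a = v ∧ c = x)) ∧
      (Odd (A.card * n) → x ∈ T v ∧ v ∉ T x) := by
  have main : ∀ f : α → ℕ, Set.BijOn f A (range A.card) →
      (Odd (A.card * n) → f v = A.card - 1 ∧ f x = A.card / 2 ∧ v ∈ A ∧ x ∈ A) →
      ∃ T : α → Finset α, (∀ a ∈ A, T a ⊆ A.erase a ∧ (T a).card = n) ∧
      (∀ a ∈ A, ∀ c ∈ T a, a ∈ T c ∨ (Odd (A.card * n) ∧ a = v ∧ c = x)) ∧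
      (Odd (A.card * n) → x ∈ T v ∧ v ∉ T x) := by
    intro f hf hodd
    have hlt : ∀ a ∈ A, f a < A.card := fun a ha => by simpa using hf.mapsTo ha
    refine ⟨fun a => A.filter fun c => Arc A.card n (f a) (f c), ?_, ?_, ?_⟩
    · intro a ha
      refine ⟨fun c hc => ?_, ?_⟩
      · rw [mem_filter] at hc
        refine mem_erase.2 ⟨?_, hc.1⟩
        rintro rfl
        have := hc.2
        unfold Arc at this
        omega
      · rw [card_filter_bijOn hf (Arc A.card n (f a)), card_filter_arc hn (hlt a ha)]
    · intro a ha c hc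
      rw [mem_filter] at hc
      rcases hc.2.symm_or hn (hlt a ha) with h | ⟨h1, h2, h3, h4⟩
      · exact Or.inl (mem_filter.2 ⟨ha, h⟩)
      · have ho : Odd (A.card * n) := (Nat.odd_iff.2 h3).mul (Nat.odd_iff.2 h4)
        obtain ⟨e1, e2, hv, hx⟩ := hodd ho
        exact Or.inr ⟨ho, hf.injOn ha hv (h1.trans e1.symm), hf.injOn hc.1 hx (h2.trans e2.symm)⟩
    · intro ho
      obtain ⟨e1, e2, hv, hx⟩ := hodd ho
      rw [Nat.odd_mul] at ho
      refine ⟨mem_filter.2 ⟨hx, ?_⟩, fun h => ?_⟩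
      · rw [e1, e2]
        exact arc_last (Nat.odd_iff.1 ho.1) (Nat.odd_iff.1 ho.2)
      have := (mem_filter.1 h).2
      rw [e1, e2] at this
      exact Arc.not_reverse hn (Nat.odd_iff.1 ho.1) (Nat.odd_iff.1 ho.2) this
  by_cases ho : Odd (A.card * n)
  · obtain ⟨h1, h2⟩ := Nat.odd_mul.1 ho
    rw [Nat.odd_iff] at h1 h2
    obtain ⟨hv, hx, hne⟩ := hvx (by omega)
    -- The labelling carries the one-way arc of the model, from `card - 1` to `card / 2`, to the
    -- prescribed arc from `v` to `x`.
    obtain ⟨f, hf, e1, e2⟩ := exists_bijOn_range_of_ne hv hx hne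
      (p := A.card - 1) (q := A.card / 2) (by omega) (by omega) (by omega)
    exact main f hf fun _ => ⟨e1, e2, hv, hx⟩
  · obtain ⟨f, hf⟩ := exists_bijOn_range A
    exact main f hf fun h => absurd h ho

/-! ### Involutions and partitions into pairs. -/

/-- Reversal of an enumeration of `A`: only the middle element, if there is one, is fixed. -/
theorem exists_involution {α : Type*} [DecidableEq α] (A : Finset α) :
    ∃ e : α → α, (∀ a ∈ A, e a ∈ A) ∧ (∀ a ∈ A, e (e a) = a) ∧
      ∀ a ∈ A, ∀ c ∈ A, e a = a → e c = c → a = c := by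
  refine ⟨fun a => if h : a ∈ A then (A.equivFin.symm (Fin.rev (A.equivFin ⟨a, h⟩))).1 else a,
    ?_, ?_, ?_⟩
  · intro a ha
    simp [ha]
  · intro a ha
    simp [ha]
  · intro a ha c hc h h'
    have key : ∀ a (ha : a ∈ A), (if h : a ∈ A then
        (A.equivFin.symm (Fin.rev (A.equivFin ⟨a, h⟩))).1 else a) = a →
        2 * (A.equivFin ⟨a, ha⟩).val + 1 = A.card := by
      intro a ha h
      rw [dif_pos ha] at h
      have h1 : Fin.rev (A.equivFin ⟨a, ha⟩) = A.equivFin ⟨a, ha⟩ := by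
        rw [← Equiv.symm_apply_eq]
        exact Subtype.ext h
      have h2 := congrArg Fin.val h1
      rw [Fin.val_rev] at h2
      have := (A.equivFin ⟨a, ha⟩).isLt
      omega
    have h1 := key a ha h
    have h2 := key c hc h'
    have h3 : A.equivFin ⟨a, ha⟩ = A.equivFin ⟨c, hc⟩ := Fin.ext (by omega)
    exact congrArg Subtype.val (A.equivFin.injective h3)

/-- The orbits of an involution with at most one fixed point. -/
theorem exists_orbit_partition {α β : Type*} [DecidableEq α] [DecidableEq β] {X : Finset α}
    {Y : Finset β} {g : β → α} {e : β → β} (hX : Y.image g = X) (hg : Set.InjOn g Y)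
    (he : ∀ y ∈ Y, e y ∈ Y) (hee : ∀ y ∈ Y, e (e y) = y)
    (hfix : ∀ y ∈ Y, ∀ z ∈ Y, e y = y → e z = z → y = z) :
    ∃ B : Finpartition X,
      (∀ p ∈ B.parts, p.card = 1 ∨ ∃ y ∈ Y, e y ≠ y ∧ p = {g y, g (e y)}) ∧
      (B.parts.filter fun p => p.card = 1).card ≤ 1 := by
  subst hX
  let parts := Y.image fun y => ({g y, g (e y)} : Finset α)
  have h1 : ∀ p ∈ parts, p ⊆ Y.image g := by
    intro p hp
    obtain ⟨y, hy, rfl⟩ := mem_image.1 hp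
    exact insert_subset (mem_image_of_mem _ hy) (singleton_subset_iff.2 (mem_image_of_mem _ (he y hy)))
  have h2 : ∀ a ∈ Y.image g, ∃! t ∈ parts, a ∈ t := by
    intro a ha
    obtain ⟨y, hy, rfl⟩ := mem_image.1 ha
    refine ⟨{g y, g (e y)}, ⟨mem_image.2 ⟨y, hy, rfl⟩, mem_insert_self _ _⟩, ?_⟩
    rintro t ⟨ht, hyt⟩
    obtain ⟨z, hz, rfl⟩ := mem_image.1 ht
    rcases mem_insert.1 hyt with h | h
    · rw [hg hy hz h]
    · have h' := hg hy (he z hz) (mem_singleton.1 h)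
      rw [h', hee z hz, pair_comm]
  have h3 : ∅ ∉ parts := by
    intro h
    obtain ⟨y, -, hy⟩ := mem_image.1 h
    exact insert_ne_empty _ _ hy
  refine ⟨Finpartition.ofExistsUnique parts h1 h2 h3, ?_, ?_⟩
  · intro p hp
    obtain ⟨y, hy, rfl⟩ := mem_image.1 hp
    by_cases h : e y = y
    · left
      simp [h]
    · exact Or.inr ⟨y, hy, h, rfl⟩
  · refine card_le_one.2 fun p hp q hq => ?_
    rw [mem_filter] at hp hq
    obtain ⟨y, hy, rfl⟩ := mem_image.1 hp.1
    obtain ⟨z, hz, rfl⟩ := mem_image.1 hq.1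
    have key : ∀ y ∈ Y, ({g y, g (e y)} : Finset α).card = 1 → e y = y := by
      intro y hy h
      by_contra hne
      rw [card_pair fun h' => hne (hg (he y hy) hy h'.symm)] at h
      omega
    rw [hfix y hy z hz (key y hy hp.2) (key z hz hq.2)]

theorem exists_injOn_of_card_le {α : Type*} [DecidableEq α] {A C : Finset α}
    (h : A.card ≤ C.card) : ∃ f : α → α, (∀ a ∈ A, f a ∈ C) ∧ Set.InjOn f A := by
  obtain ⟨g⟩ := Function.Embedding.nonempty_of_card_le (α := A) (β := C) (by simpa using h)
  refine ⟨fun a => if h : a ∈ A then (g ⟨a, h⟩).1 else a, fun a ha => ?_, fun a ha c hc h => ?_⟩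
  · simp [ha]
  · have ha : a ∈ A := ha
    have hc : c ∈ A := hc
    simp only [ha, hc, dif_pos] at h
    exact congrArg Subtype.val (g.injective (Subtype.ext h))

/-! ### Construction of the sets `Λ` and `Δ` and of the pairing in Step 4. -/

theorem exists_pair_map (hK : 2 ≤ K) :
    ∃ pr : Fin K → Fin K → Pair K, ∀ a c, a ≠ c → (pr a c).1 = {a, c} := by
  have h : ∀ a c : Fin K, ∃ s : Pair K, a ≠ c → s.1 = {a, c} := by
    intro a c
    by_cases hac : a = c
    · exact ⟨⟨{⟨0, by omega⟩, ⟨1, by omega⟩}, card_pair (by rw [Ne, Fin.ext_iff]; norm_num)⟩, fun h => absurd hac h⟩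
    · exact ⟨⟨{a, c}, card_pair hac⟩, fun _ => rfl⟩
  choose pr hpr using h
  exact ⟨pr, hpr⟩

theorem pair_eq_pair_iff_right {α : Type*} [DecidableEq α] {a c j : α} (ha : a ≠ j)
    (h : ({j, a} : Finset α) = {j, c}) : a = c := by
  have : a ∈ ({j, c} : Finset α) := h ▸ mem_insert_of_mem (mem_singleton_self a)
  rcases mem_insert.1 this with h1 | h1
  · exact absurd h1 ha
  · exact mem_singleton.1 h1

/-- An approximately uniform partition of the pairs in `A`, every part consisting of pairs through
the point that indexes it. -/
theorem exists_uniform_partition (hK : 2 ≤ K) (A : Finset (Fin K)) :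
    ∃ L : Fin K → Finset (Pair K), (∀ j ∈ A, ∀ s ∈ L j, s.1 ⊆ A ∧ j ∈ s.1) ∧
      (∀ s : Pair K, s.1 ⊆ A → ∃ j ∈ A, s ∈ L j) ∧
      (∀ j ∈ A, ∀ k ∈ A, j ≠ k → Disjoint (L j) (L k)) ∧
      ∀ j ∈ A, (L j).card = (A.card - 1) / 2 ∨ (L j).card = A.card / 2 := by
  obtain ⟨pr, hpr⟩ := exists_pair_map hK
  obtain ⟨T, hT, hTT, hcard⟩ := exists_tournament A
  have hTA : ∀ j ∈ A, ∀ k ∈ T j, k ∈ A ∧ j ≠ k := fun j hj k hk =>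
    ⟨mem_of_mem_erase (hT j hj hk), (ne_of_mem_erase (hT j hj hk)).symm⟩
  -- The pair `{j, k}` is assigned to the winner of the match between `j` and `k`.
  refine ⟨fun j => (T j).image (pr j), ?_, ?_, ?_, ?_⟩
  · intro j hj s hs
    obtain ⟨k, hk, rfl⟩ := mem_image.1 hs
    obtain ⟨hkA, hjk⟩ := hTA j hj k hk
    rw [hpr j k hjk]
    exact ⟨insert_subset hj (singleton_subset_iff.2 hkA), mem_insert_self _ _⟩
  · intro s hs
    obtain ⟨a, c, hac, hsac⟩ := card_eq_two.1 s.2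
    have ha : a ∈ A := hs (by simp [hsac])
    have hc : c ∈ A := hs (by simp [hsac])
    rcases (hTT a ha c hc hac).1 with h | h
    · exact ⟨a, ha, mem_image.2 ⟨c, h, Subtype.ext ((hpr a c hac).trans hsac.symm)⟩⟩
    · refine ⟨c, hc, mem_image.2 ⟨a, h, Subtype.ext ?_⟩⟩
      rw [hpr c a hac.symm, hsac, pair_comm]
  · intro j hj k hk hjk
    refine disjoint_left.2 fun s h h' => ?_
    obtain ⟨a, ha, rfl⟩ := mem_image.1 h
    obtain ⟨c, hc, hac⟩ := mem_image.1 h'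
    have e : ({k, c} : Finset (Fin K)) = {j, a} := by
      rw [← hpr k c (hTA k hk c hc).2, ← hpr j a (hTA j hj a ha).2, hac]
    have hka : k = a := by
      have : k ∈ ({j, a} : Finset (Fin K)) := e ▸ mem_insert_self _ _
      rcases mem_insert.1 this with h1 | h1
      · exact absurd h1.symm hjk
      · exact mem_singleton.1 h1
    have hjc : j = c := by
      have : j ∈ ({k, c} : Finset (Fin K)) := e ▸ mem_insert_self _ _
      rcases mem_insert.1 this with h1 | h1
      · exact absurd h1 hjk
      · exact mem_singleton.1 h1
    subst hka hjc
    exact (hTT j hj k hk hjk).2 ⟨ha, hc⟩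
  · intro j hj
    rw [card_image_of_injOn]
    · exact hcard j hj
    · intro a ha c hc h
      have h' := congrArg Subtype.val h
      rw [hpr j a (hTA j hj a ha).2, hpr j c (hTA j hj c hc).2] at h'
      exact pair_eq_pair_iff_right (hTA j hj a ha).2.symm h'

/-- Families of digraphs on `H`, one for every point of `L`, with prescribed constant out-degrees,
whose arcs can be divided into opposite pairs and at most one remaining arc. A triple `(i, k, j)`
denotes the arc from `i` to `k` in the digraph at `j`. -/
theorem exists_paired_digraphs {α : Type*} [LinearOrder α] (H L : Finset α) (deg : α → ℕ)
    (hdeg : ∀ j ∈ L, H.Nonempty → deg j < H.card) :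
    ∃ (T : α → α → Finset α) (e : α × α × α → α × α × α),
      (∀ j ∈ L, ∀ i ∈ H, T j i ⊆ H.erase i ∧ (T j i).card = deg j) ∧
      (∀ y, (y.2.2 ∈ L ∧ y.1 ∈ H ∧ y.2.1 ∈ T y.2.2 y.1) →
        ((e y).2.2 ∈ L ∧ (e y).1 ∈ H ∧ (e y).2.1 ∈ T (e y).2.2 (e y).1) ∧ e (e y) = y ∧
        (e y = y ∨ ((e y).1 = y.2.1 ∧ (e y).2.1 = y.1))) ∧
      ∀ y z, (y.2.2 ∈ L ∧ y.1 ∈ H ∧ y.2.1 ∈ T y.2.2 y.1) →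
        (z.2.2 ∈ L ∧ z.1 ∈ H ∧ z.2.1 ∈ T z.2.2 z.1) → e y = y → e z = z → y = z := by
  classical
  rcases H.eq_empty_or_nonempty with rfl | hH
  · exact ⟨fun _ _ => ∅, id, by simp, by simp, by simp⟩
  obtain ⟨v, x, hvx⟩ : ∃ v x, 1 < H.card → v ∈ H ∧ x ∈ H ∧ v ≠ x := by
    by_cases h : 1 < H.card
    · obtain ⟨v, hv, x, hx, hne⟩ := one_lt_card.1 h
      exact ⟨v, x, fun _ => ⟨hv, hx, hne⟩⟩
    · exact ⟨hH.choose, hH.choose, fun h' => absurd h' h⟩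
  -- The points whose digraph has an odd number of arcs; `σ` pairs them, with at most one left over.
  let O := L.filter fun j => Odd (H.card * deg j)
  obtain ⟨σ, hσ, hσσ, hσfix⟩ := exists_involution O
  -- The exceptional arc at `j` goes from `p j` to `q j`. The order decides which of `j` and `σ j`
  -- gets the reversed direction, so that the two exceptional arcs are opposite.
  let p : α → α := fun j => if σ j < j then x else v
  let q : α → α := fun j => if σ j < j then v else x
  have hpq : ∀ j, 1 < H.card → p j ∈ H ∧ q j ∈ H ∧ p j ≠ q j := by
    intro j h
    obtain ⟨h1, h2, h3⟩ := hvx h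
    simp only [p, q]
    split_ifs
    · exact ⟨h2, h1, h3.symm⟩
    · exact ⟨h1, h2, h3⟩
  have hswap : ∀ j ∈ O, σ j ≠ j → p (σ j) = q j ∧ q (σ j) = p j := by
    intro j hj hne
    simp only [p, q]
    rw [hσσ j hj]
    rcases lt_or_gt_of_ne hne with h | h
    · rw [if_pos h, if_pos h, if_neg h.not_gt, if_neg h.not_gt]
      exact ⟨rfl, rfl⟩
    · rw [if_neg h.not_gt, if_neg h.not_gt, if_pos h, if_pos h]
      exact ⟨rfl, rfl⟩
  have hex : ∀ j, ∃ T : α → Finset α, j ∈ L → (∀ a ∈ H, T a ⊆ H.erase a ∧ (T a).card = deg j) ∧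
      (∀ a ∈ H, ∀ c ∈ T a, a ∈ T c ∨ (Odd (H.card * deg j) ∧ a = p j ∧ c = q j)) ∧
      (Odd (H.card * deg j) → q j ∈ T (p j) ∧ p j ∉ T (q j)) := by
    intro j
    by_cases hj : j ∈ L
    · obtain ⟨T, hT⟩ := exists_regular_digraph (hdeg j hj hH) (hpq j)
      exact ⟨T, fun _ => hT⟩
    · exact ⟨fun _ => ∅, fun h => absurd h hj⟩
  choose T hT using hex
  have hO : ∀ j ∈ O, j ∈ L ∧ Odd (H.card * deg j) := fun j hj => mem_filter.1 hj
  have hH1 : ∀ j ∈ O, 1 < H.card := by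
    intro j hj
    have h := hdeg j (hO j hj).1 hH
    have := (Nat.odd_mul.1 (hO j hj).2).2.pos
    omega
  let bad : α × α × α → Prop := fun y => y.2.2 ∈ O ∧ y.1 = p y.2.2 ∧ y.2.1 = q y.2.2
  -- An ordinary arc is paired with its reverse in the same digraph, the exceptional one at `j` with
  -- that at `σ j`. The only fixed arc is the exceptional one at a fixed point of `σ`.
  let e : α × α × α → α × α × α := fun y =>
    if bad y then (if σ y.2.2 = y.2.2 then y else (y.2.1, y.1, σ y.2.2)) else (y.2.1, y.1, y.2.2)
  have hbad : ∀ i k j, bad (i, k, j) → σ j ≠ j → bad (k, i, σ j) := by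
    rintro i k j ⟨hj, h1, h2⟩ hne
    obtain ⟨h3, h4⟩ := hswap j hj hne
    exact ⟨hσ j hj, h2.trans h3.symm, h1.trans h4.symm⟩
  have hnbad : ∀ i k j, j ∈ L → i ∈ H → k ∈ T j i → ¬ bad (i, k, j) →
      i ∈ T j k ∧ ¬ bad (k, i, j) := by
    intro i k j hj hi hk hb
    refine ⟨((hT j hj).2.1 i hi k hk).resolve_right fun ⟨h1, h2⟩ =>
      hb ⟨mem_filter.2 ⟨hj, h1⟩, h2⟩, ?_⟩
    rintro ⟨h1, h2, h3⟩
    have h2 : k = p j := h2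
    have h3 : i = q j := h3
    rw [h2, h3] at hk
    exact ((hT j hj).2.2 (hO j h1).2).2 hk
  refine ⟨T, e, fun j hj => (hT j hj).1, ?_, ?_⟩
  · rintro ⟨i, k, j⟩ ⟨hj, hi, hk⟩
    simp only at hj hi hk
    by_cases hb : bad (i, k, j)
    · by_cases hs : σ j = j
      · have he : e (i, k, j) = (i, k, j) := by simp only [e]; rw [if_pos hb, if_pos hs]
        rw [he, he]
        exact ⟨⟨hj, hi, hk⟩, rfl, Or.inl rfl⟩
      · have he : e (i, k, j) = (k, i, σ j) := by simp only [e]; rw [if_pos hb, if_neg hs]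
        have hb' := hbad i k j hb hs
        have hjO : j ∈ O := hb.1
        have hs' : ¬ σ (σ j) = σ j := by rw [hσσ j hjO]; exact fun h => hs h.symm
        have he' : e (k, i, σ j) = (i, k, j) := by
          simp only [e]; rw [if_pos hb', if_neg hs', hσσ j hjO]
        rw [he, he']
        obtain ⟨h1, h2, h3⟩ := hb'
        simp only at h1 h2 h3
        have hL := hO _ h1
        refine ⟨⟨hL.1, ?_, ?_⟩, rfl, Or.inr ⟨rfl, rfl⟩⟩
        · simp only [h2]
          exact (hpq _ (hH1 j hjO)).1
        · simp only [h2, h3]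
          exact ((hT _ hL.1).2.2 hL.2).1
    · have he : e (i, k, j) = (k, i, j) := by simp only [e]; rw [if_neg hb]
      obtain ⟨h1, h2⟩ := hnbad i k j hj hi hk hb
      have he' : e (k, i, j) = (i, k, j) := by simp only [e]; rw [if_neg h2]
      rw [he, he']
      exact ⟨⟨hj, mem_of_mem_erase (((hT j hj).1 i hi).1 hk), h1⟩, rfl, Or.inr ⟨rfl, rfl⟩⟩
  · have key : ∀ y : α × α × α, (y.2.2 ∈ L ∧ y.1 ∈ H ∧ y.2.1 ∈ T y.2.2 y.1) → e y = y →
        bad y ∧ σ y.2.2 = y.2.2 := by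
      rintro ⟨i, k, j⟩ ⟨hj, hi, hk⟩ he
      simp only at hj hi hk
      have hne : k ≠ i := ne_of_mem_erase (((hT j hj).1 i hi).1 hk)
      simp only [e] at he
      split_ifs at he with h1 h2
      · exact ⟨h1, h2⟩
      · exact absurd (congrArg Prod.fst he) hne
      · exact absurd (congrArg Prod.fst he) hne
    rintro ⟨i, k, j⟩ ⟨i', k', j'⟩ hy hz h h'
    obtain ⟨⟨h1, h2, h3⟩, h4⟩ := key _ hy h
    obtain ⟨⟨h1', h2', h3'⟩, h4'⟩ := key _ hz h'
    simp only at h1 h2 h3 h4 h1' h2' h3' h4'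
    obtain rfl := hσfix j h1 j' h1' h4 h4'
    rw [h2, h3, h2', h3']

/-- The choice of the sets `Δ_{i,j}` of given cardinalities, and of the pairing of their elements. -/
theorem exists_paired_Del (hK : 2 ≤ K) {d : Fin K → Fin N} (deg : Fin K → ℕ)
    (hdeg : ∀ j ∈ Kl Nh Nr d, (Kh Nh d).Nonempty → deg j < (Kh Nh d).card) :
    ∃ E : Fin K → Fin K → Finset (Pair K),
      (∀ i ∈ Kh Nh d, ∀ j ∈ Kl Nh Nr d, E i j ⊆ setOmega Nh d i j ∧ (E i j).card = deg j) ∧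
      ∃ B : Finpartition (univ.filter fun x : Fin K × Pair K =>
        x.1 ∈ Kh Nh d ∧ ∃ j ∈ Kl Nh Nr d, x.2 ∈ E x.1 j),
        (∀ p ∈ B.parts, p.card = 1 ∨
          ∃ i k : Fin K, ∃ s t : Pair K, i ≠ k ∧ i ∈ t.1 ∧ k ∈ s.1 ∧ p = {(i, s), (k, t)}) ∧
        (B.parts.filter fun p => p.card = 1).card ≤ 1 := by
  obtain ⟨pr, hpr⟩ := exists_pair_map hK
  obtain ⟨T, e, hT, he, hfix⟩ := exists_paired_digraphs (Kh Nh d) (Kl Nh Nr d) deg hdeg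
  have hTH : ∀ j ∈ Kl Nh Nr d, ∀ i ∈ Kh Nh d, ∀ k ∈ T j i, k ∈ Kh Nh d ∧ k ≠ i ∧ j ≠ k :=
    fun j hj i hi k hk => by
      have h := mem_erase.1 ((hT j hj i hi).1 hk)
      exact ⟨h.2, h.1, (ne_of_mem_Kh_of_mem_Kl h.2 hj).symm⟩
  have hval : ∀ j ∈ Kl Nh Nr d, ∀ i ∈ Kh Nh d, ∀ k ∈ T j i, (pr j k).1 = {j, k} :=
    fun j hj i hi k hk => hpr j k (hTH j hj i hi k hk).2.2
  have hsub : ∀ i ∈ Kh Nh d, ∀ j ∈ Kl Nh Nr d, (T j i).image (pr j) ⊆ setOmega Nh d i j := by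
    intro i hi j hj s hs
    obtain ⟨k, hk, rfl⟩ := mem_image.1 hs
    obtain ⟨h1, h2, h3⟩ := hTH j hj i hi k hk
    rw [mem_setOmega, hval j hj i hi k hk]
    refine ⟨⟨?_, mem_insert_self _ _⟩, k, h1, mem_insert_of_mem (mem_singleton_self _)⟩
    simp only [mem_insert, mem_singleton, not_or]
    exact ⟨ne_of_mem_Kh_of_mem_Kl hi hj, h2.symm⟩
  have hinj : ∀ i ∈ Kh Nh d, ∀ j ∈ Kl Nh Nr d, ∀ k ∈ T j i, ∀ k' ∈ T j i,
      pr j k = pr j k' → k = k' := by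
    intro i hi j hj k hk k' hk' h
    have h' := congrArg Subtype.val h
    rw [hval j hj i hi k hk, hval j hj i hi k' hk'] at h'
    exact pair_eq_pair_iff_right (hTH j hj i hi k hk).2.2.symm h'
  refine ⟨fun i j => (T j i).image (pr j), fun i hi j hj => ⟨hsub i hi j hj, ?_⟩, ?_⟩
  · rw [card_image_of_injOn fun k hk k' hk' h => hinj i hi j hj k hk k' hk' h]
    exact (hT j hj i hi).2
  let Y : Finset (Fin K × Fin K × Fin K) :=
    univ.filter fun y => y.2.2 ∈ Kl Nh Nr d ∧ y.1 ∈ Kh Nh d ∧ y.2.1 ∈ T y.2.2 y.1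
  have hY : ∀ {y}, y ∈ Y ↔ y.2.2 ∈ Kl Nh Nr d ∧ y.1 ∈ Kh Nh d ∧ y.2.1 ∈ T y.2.2 y.1 := by
    intro y
    simp [Y]
  -- The arc `(i, k, j)` becomes `W_{d_i,{j,k}}`, stored by `k`; an opposite arc `(k, i, j')`
  -- becomes `W_{d_k,{j',i}}`, stored by `i`.
  let g : Fin K × Fin K × Fin K → Fin K × Pair K := fun y => (y.1, pr y.2.2 y.2.1)
  have hg : Set.InjOn g Y := by
    rintro ⟨i, k, j⟩ hy ⟨i', k', j'⟩ hy' h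
    obtain ⟨hj, hi, hk⟩ := hY.1 hy
    obtain ⟨hj', hi', hk'⟩ := hY.1 hy'
    simp only at hj hi hk hj' hi' hk'
    obtain rfl : i = i' := congrArg Prod.fst h
    have h2 : pr j k = pr j' k' := congrArg Prod.snd h
    have hs := hsub i hi j hj (mem_image_of_mem _ hk)
    obtain rfl : j = j' := setOmega_unique_low hs hj hj' (by
      rw [h2, hval j' hj' i hi k' hk']; exact mem_insert_self _ _)
    rw [hinj i hi j hj k hk k' hk' h2]
  have hX : Y.image g = univ.filter fun x : Fin K × Pair K =>
      x.1 ∈ Kh Nh d ∧ ∃ j ∈ Kl Nh Nr d, x.2 ∈ (T j x.1).image (pr j) := by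
    ext ⟨i, s⟩
    simp only [mem_image, mem_filter, mem_univ, true_and]
    constructor
    · rintro ⟨⟨i', k, j⟩, hy, h⟩
      obtain ⟨hj, hi, hk⟩ := hY.1 hy
      obtain rfl : i' = i := congrArg Prod.fst h
      exact ⟨hi, j, hj, k, hk, congrArg Prod.snd h⟩
    · rintro ⟨hi, j, hj, k, hk, rfl⟩
      exact ⟨(i, k, j), hY.2 ⟨hj, hi, hk⟩, rfl⟩
  obtain ⟨B, hB, hB1⟩ := exists_orbit_partition (e := e) hX hg
    (fun y hy => hY.2 (he y (hY.1 hy)).1) (fun y hy => (he y (hY.1 hy)).2.1)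
    (fun y hy z hz => hfix y z (hY.1 hy) (hY.1 hz))
  refine ⟨B, fun p hp => (hB p hp).imp_right ?_, hB1⟩
  rintro ⟨⟨i, k, j⟩, hy, hne, rfl⟩
  have hy := hY.1 hy
  obtain ⟨hy', -, h | ⟨h1, h2⟩⟩ := he _ hy
  · exact absurd h hne
  generalize e (i, k, j) = z at *
  obtain ⟨k', i', j'⟩ := z
  simp only at hy hy' h1 h2
  subst h1 h2
  refine ⟨i', k', pr j k', pr j' i', (hTH j hy.1 i' hy.2.1 k' hy.2.2).2.1.symm, ?_, ?_, rfl⟩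
  · rw [hval j' hy'.1 k' hy'.2.1 i' hy'.2.2]
    simp
  · rw [hval j hy.1 i' hy.2.1 k' hy.2.2]
    simp

/-! ### Existence of the delivery. -/

theorem nonempty_delivery (hK3 : 3 ≤ K) (hN : Nh + Nr ≤ N)
    (P : Placement K N Nh Nr) (d : Fin K → Fin N) : Nonempty (Delivery P d) := by
  obtain ⟨L, hL, hLcover, hLdisj, hLcard⟩ :=
    exists_uniform_partition (by omega : 2 ≤ K) (Kl Nh Nr d)
  obtain ⟨E, hE, B, hB, hB1⟩ := exists_paired_Del (Nh := Nh) (Nr := Nr) (by omega : 2 ≤ K) (d := d)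
    (fun j => nOf ((Kh Nh d).card - 1) (L j).card (Kr Nr d).card ((K - 1) / 2)) (by
      intro j _ h
      have := card_pos.2 h
      unfold nOf
      omega)
  have hQ : ∀ i j, ∃ Q ⊆ setZ Nr d i j, Q.card = (setZ Nr d i j).card -
      sigmaOf (L j).card (setZ Nr d i j).card (setH P d i j).card :=
    fun i j => exists_subset_card_eq (Nat.sub_le _ _)
  choose Q hQ hQcard using hQ
  have hlow : ∀ j k, ∃ f : Pair K → Pair K, j ∈ Kl Nh Nr d → k ∈ Kl Nh Nr d →
      Set.BijOn f (setH P d k j) (setH P d j k) := by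
    intro j k
    by_cases h : j ∈ Kl Nh Nr d ∧ k ∈ Kl Nh Nr d
    · have hc : (setH P d k j).card = (setH P d j k).card := by
        rw [card_setH h.1, card_setH h.2]
      obtain ⟨f, hf, hfi⟩ := exists_injOn_of_card_le hc.le
      exact ⟨f, fun _ _ => ⟨hf, hfi, surjOn_of_injOn_of_card_le f hf hfi hc.ge⟩⟩
    · exact ⟨id, fun h1 h2 => absurd ⟨h1, h2⟩ h⟩
  choose low hlow using hlow
  have hLsub : ∀ j ∈ Kl Nh Nr d, L j ⊆ setLambda Nh Nr d :=
    fun j hj s hs => mem_setLambda.2 (hL j hj s hs).1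
  -- A high-level user exists, so `kl ≤ K - 1`. This bound yields `σ ≤ |Z|`, so that `Π` has the
  -- right size, and `|F| ≤ |H|`, so that the injection `cross` exists.
  have hle : ∀ i ∈ Kh Nh d, ∀ j ∈ Kl Nh Nr d, (L j).card ≤ (K - 1) / 2 := by
    intro i hi j hj
    have h1 := hLcard j hj
    have h2 := card_levels hN d
    have h3 := card_pos.2 ⟨i, hi⟩
    omega
  have hcross : ∀ i j, ∃ f : Pair K → Pair K, i ∈ Kh Nh d → j ∈ Kl Nh Nr d →
      (∀ s ∈ L j ∪ Q i j ∪ (setOmega Nh d i j \ E i j), f s ∈ setH P d i j) ∧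
      Set.InjOn f (L j ∪ Q i j ∪ (setOmega Nh d i j \ E i j) : Finset (Pair K)) := by
    intro i j
    by_cases h : i ∈ Kh Nh d ∧ j ∈ Kl Nh Nr d
    · obtain ⟨hi, hj⟩ := h
      have hc : (L j ∪ Q i j ∪ (setOmega Nh d i j \ E i j)).card ≤ (setH P d i j).card := by
        have h1 := hE i hi j hj
        have h2 := hQcard i j
        have h3 := hle i hi j hj
        rw [card_union_levels hN hj (hLsub j hj) (hQ i j) sdiff_subset, card_sdiff_of_subset h1.1,
          h1.2, h2, card_setH hj, card_setZ hN hi hj, card_setOmega hi hj]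
        unfold sigmaOf nOf
        omega
      obtain ⟨f, hf, hfi⟩ := exists_injOn_of_card_le hc
      exact ⟨f, fun _ _ => ⟨hf, hfi⟩⟩
    · exact ⟨id, fun h1 h2 => absurd ⟨h1, h2⟩ h⟩
  choose cr hcr using hcross
  exact ⟨{
    lowPair := low
    lowPair_bij := fun j hj k hk _ => hlow j k hj hk
    Lam := fun _ j => L j
    Lam_subset := fun i hi j hj s hs => mem_setL.2
      ⟨fun his => disjoint_left.1 (disjoint_Kh_Kl d) hi ((hL j hj s hs).1 his), (hL j hj s hs).2⟩
    Lam_cover := fun i _ => by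
      refine Subset.antisymm (biUnion_subset.2 hLsub) fun s hs => mem_biUnion.2 ?_
      exact hLcover s (mem_setLambda.1 hs)
    Lam_disjoint := fun _ _ => hLdisj
    Lam_uniform := fun i _ j hj k hk => by
      have h1 := hLcard j hj
      have h2 := hLcard k hk
      omega
    Lam_same := fun _ _ _ _ _ _ => rfl
    Pi := Q
    Pi_subset := fun i _ j _ => hQ i j
    Pi_card := fun i hi j hj => by
      have h3 := hle i hi j hj
      rw [card_sdiff_of_subset (hQ i j), hQcard, card_setH hj]
      unfold sigmaOf
      omega
    Del := E
    Del_subset := fun i hi j hj => (hE i hi j hj).1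
    Del_card := fun i hi j hj => by
      rw [(hE i hi j hj).2, card_setH hj, card_setZ hN hi hj, card_setOmega hi hj]
    cross := cr
    cross_maps := fun i hi j hj => (hcr i j hi hj).1
    cross_inj := fun i hi j hj => (hcr i j hi hj).2
    B := B
    B_parts := hB
    B_single := hB1 }⟩

end CL210

theorem mainTheorem2 (K N Nh Nr b : ℕ) (hK : Odd K) (hK3 : 3 ≤ K) (hN : Nh + Nr ≤ N) (hb : 0 < b) :
    Nonempty (CL210.Placement K N Nh Nr) ∧
    ∀ P : CL210.Placement K N Nh Nr,
      -- every cache holds `M * F` bits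
      (∀ u : Fin K, (((P.cache u).card * b : ℕ) : ℚ) =
        CL210.cacheSize K N Nh Nr * (CL210.fileSize K b : ℚ)) ∧
      ∀ (d : Fin K → Fin N) (kh kl kr : ℕ), kh = (CL210.Kh Nh d).card →
        kl = (CL210.Kl Nh Nr d).card → kr = (CL210.Kr Nr d).card →
        -- the delivery phase can be carried out
        Nonempty (CL210.Delivery P d) ∧
        ∀ D : CL210.Delivery P d,
          -- the quantities `|F|`, `|Λ|`, `σ` and `n`
          (∀ i ∈ CL210.Kh Nh d, ∀ j ∈ CL210.Kl Nh Nr d,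
            (¬ (kh = 1 ∧ kr = 0) → (D.F i j).card = (CL210.setH P d i j).card) ∧
            ((D.Lam i j).card = (kl - 1) / 2 ∨ (D.Lam i j).card = kl / 2) ∧
            D.sigma i j = CL210.sigmaOf (D.Lam i j).card kr ((K - 1) / 2) ∧
            D.n i j = CL210.nOf (kh - 1) (D.Lam i j).card kr ((K - 1) / 2)) ∧
          -- the number of messages in each step
          D.step1.card = (kh + kr).choose 3 - kr.choose 3 ∧
          D.step2.card = (K - 1) / 2 * kl.choose 2 ∧
          D.step3.card = (K - 1) / 2 * (kh * kl) ∧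
          D.step4.card =
            ⌈((∑ i ∈ CL210.Kh Nh d, ∑ j ∈ CL210.Kl Nh Nr d, D.n i j : ℕ) : ℚ) / 2⌉₊ ∧
          D.step5low.card = kl * kr * ((K - 1) / 2) ∧
          D.step5high.card = ∑ i ∈ CL210.Kh Nh d, ∑ j ∈ CL210.Kl Nh Nr d, D.sigma i j ∧
          D.step5zero.card = kr * K.choose 2 ∧
          -- their total, as a function of `k = [kh, kl, kr]`
          D.step1.card + D.step2.card + D.step3.card + D.step4.card +
            (D.step5low.card + D.step5high.card) = CL210.NT K kh kl kr ∧
          -- every user recovers the requested file, at the stated rate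
          D.Decodable b ∧
          D.rate b = (CL210.NT K kh kl kr : ℚ) / (K.choose 2 : ℚ) + (kr : ℚ) := by
  refine ⟨CL210.nonempty_placement hK, fun P => ⟨P.cache_bits hK hN b, ?_⟩⟩
  rintro d _ _ _ rfl rfl rfl
  refine ⟨CL210.nonempty_delivery hK3 hN P d, fun D => ⟨fun i hi j hj => ⟨?_, ?_, ?_, ?_⟩,
    D.card_step1 hN, D.card_step2, D.card_step3, D.card_step4, D.card_step5low, D.card_step5high,
    D.card_step5zero, D.card_steps hN, D.decodable hN b, D.rate_eq hK3 hN hb⟩⟩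
  · exact D.card_F hK hN hi hj
  · exact D.card_Lam hi hj
  · exact D.sigma_eq hN hi hj
  · exact D.n_eq hN hi hj
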